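/- Let $\lambda,\nu>0$ and $\rho=\lambda/\nu$. Consider an M/M/1 queue with arrival rate $\lambda$ and service rate $\nu$ (one server, first-in-first-out): the interarrival times are i.i.d. exponential with rate $\lambda$, the service times are i.i.d. exponential with rate $\nu$, the initial number of customers $S_1\in\{0,1,2,\dots\}$ is random with an arbitrary law, and all of these are independent; a service in progress at time $0$ and the first interarrival period start at time $0$. Let $E_i\in\{\text{arrival},\text{departure}\}$ be the type of the $i$-th event and $T_i$ the time between events $i-1$ and $i$ (event $0$ meaning time $0$). Let $$\mathbb P_i^{event}(\cdot)=\mathbb P\bigl(E_i=\cdot\mid S_1,T_1,E_1,\dots,T_{i-1},E_{i-1},T_i\bigr),\qquad \mathbb P_i^{time}(\cdot)=\mathbb P\bigl(T_i\in\cdot\mid S_1,T_1,E_1,\dots,T_{i-1},E_{i-1}\bigr)$$ be the conditional laws evaluated at the realized history. Then, for every $i$, $\mathbb P_i^{time}$ is almost surely an exponential distribution; let $\lambda_i$ be its (random, history-dependent) rate. Moreover, the following limits hold almost surely. If $\rho<1$, then $$\lim_{N\to\infty}-\frac1N\sum_{i=1}^N\log \mathbb P_i^{event}(E_i)=-\frac12\left[\frac{\lambda}{\nu}\log\frac{\lambda}{\lambda+\nu}+\log\frac{\nu}{\lambda+\nu}\right],\qquad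 \lim_{N\to\infty}\frac1N\sum_{i=1}^N\left(\frac1{\lambda_i}-T_i\right)^2=\frac1{2\lambda^2}\cdot\frac{\nu}{\lambda+\nu}.$$ If $\rho\ge 1$, then $$\lim_{N\to\infty}-\frac1N\sum_{i=1}^N\log \mathbb P_i^{event}(E_i)=-\frac{\lambda}{\lambda+\nu}\log\frac{\lambda}{\lambda+\nu}-\frac{\nu}{\lambda+\nu}\log\frac{\nu}{\lambda+\nu},\qquad \lim_{N\to\infty}\frac1N\sum_{i=1}^N\left(\frac1{\lambda_i}-T_i\right)^2=\frac1{(\lambda+\nu)^2}.$$ -/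

import Mathlib

open MeasureTheory ProbabilityTheory Filter Topology

noncomputable section

namespace MM1

/-- The two types of events of a single-server queue. -/
inductive EventType where
  | arrival : EventType
  | departure : EventType

instance : MeasurableSpace EventType := ⊤

instance : DiscreteMeasurableSpace EventType := ⟨fun _ => trivial⟩

instance : Nonempty EventType := ⟨EventType.arrival⟩

instance : Finite EventType :=
  Finite.of_injective
    (fun e : EventType => match e with
      | EventType.arrival => true
      | EventType.departure => false)
    (by intro a b h; cases a <;> cases b <;> simp_all)

/-! ### Dynamics of a first-in-first-out single-server queue -/

/-- The full state `(q, a, s)` of a single-server queue just after an event: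
* `q` is the number of customers in the system;
* `a 0` is the time left until the next arrival, and `a 1, a 2, …` are the interarrival times
  after that arrival;
* if `q ≠ 0`, `s 0` is the remaining service time of the customer in service, and `s 1, s 2, …`
  are the service times of the next customers, in order of arrival; if `q = 0`, the server is
  idle and `s 0, s 1, …` are the service times of the next customers. -/
abbrev SimState : Type := ℕ × (ℕ → ℝ) × (ℕ → ℝ)

/-- Drop the current entry of a sequence of times (its clock has run out). -/
def shift (x : ℕ → ℝ) : ℕ → ℝ := fun k => x (k + 1)

/-- Let the current clock of a sequence of times run for `t` units of time. -/
def elapse (t : ℝ) (x : ℕ → ℝ) : ℕ → ℝ := Function.update x 0 (x 0 - t)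

/-- The type of the next event: an arrival if the server is idle or if the next arrival comes
before the end of the current service, and a departure otherwise. -/
def nextEvent (z : SimState) : EventType :=
  if z.1 = 0 ∨ z.2.1 0 ≤ z.2.2 0 then EventType.arrival else EventType.departure

/-- The time until the next event. -/
def nextTime (z : SimState) : ℝ :=
  if z.1 = 0 ∨ z.2.1 0 ≤ z.2.2 0 then z.2.1 0 else z.2.2 0

/-- The state just after the next event. The clock of the current service runs only while the
server is busy. -/
def step (z : SimState) : SimState :=
  if z.1 = 0 then
    (1, shift z.2.1, z.2.2)
  else if z.2.1 0 ≤ z.2.2 0 then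
    (z.1 + 1, shift z.2.1, elapse (z.2.1 0) z.2.2)
  else
    (z.1 - 1, elapse (z.2.2 0) z.2.1, shift z.2.2)

variable {Ω : Type*} [MeasurableSpace Ω]

/-- `S`, `A`, `V` are the data of an M/M/1 queue with arrival rate `lam` and service rate `nu`:
`S` is the initial number of customers (of any law), the interarrival times `A 0, A 1, …` are
exponential of rate `lam`, the service times `V 0, V 1, …` are exponential of rate `nu`, and
all of these random variables are independent. -/
structure IsMM1Queue (lam nu : ℝ) (P : Measure Ω)
    (S : Ω → ℕ) (A V : ℕ → Ω → ℝ) : Prop where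
  measurable_init : Measurable S
  measurable_arrival : ∀ k, Measurable (A k)
  measurable_service : ∀ k, Measurable (V k)
  law_arrival : ∀ k, P.map (A k) = expMeasure lam
  law_service : ∀ k, P.map (V k) = expMeasure nu
  indep_times : iIndepFun (fun i : ℕ ⊕ ℕ => Sum.elim A V i) P
  indep_init : IndepFun S (fun ω => ((fun k => A k ω), (fun k => V k ω))) P

/-- The state of the queue after `n` events, when `S` customers are present at time `0`. -/
def simState (S : Ω → ℕ) (A V : ℕ → Ω → ℝ) (n : ℕ) (ω : Ω) : SimState :=
  step^[n] (S ω, (fun k => A k ω), (fun k => V k ω))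

/-! ### The event table; events are numbered `0, 1, 2, …` -/

/-- The inter-event time before event `n`. -/
def interTime (S : Ω → ℕ) (A V : ℕ → Ω → ℝ) (n : ℕ) (ω : Ω) : ℝ :=
  nextTime (simState S A V n ω)

/-- The type of event `n`. -/
def eventType (S : Ω → ℕ) (A V : ℕ → Ω → ℝ) (n : ℕ) (ω : Ω) : EventType :=
  nextEvent (simState S A V n ω)

/-- The observed history before step `n`: the initial state and the inter-event times and types
of the events `0, …, n - 1`. -/
def history (S : Ω → ℕ) (A V : ℕ → Ω → ℝ) (n : ℕ) (ω : Ω) : ℕ × (Fin n → ℝ × EventType) :=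
  (S ω, fun i => (interTime S A V i ω, eventType S A V i ω))

/-! ### The oracle predictor: conditional laws given the observed history -/

/-- The conditional law of the inter-event time `n` given the history before step `n`,
evaluated at the realized history. -/
def timeLaw (P : Measure Ω) [IsProbabilityMeasure P] (S : Ω → ℕ) (A V : ℕ → Ω → ℝ)
    (n : ℕ) (ω : Ω) : Measure ℝ :=
  condDistrib (interTime S A V n) (history S A V n) P (history S A V n ω)

/-- The conditional law of the type of event `n` given the history before step `n` and the
inter-event time `n`, evaluated at their realized values. -/
def eventLaw (P : Measure Ω) [IsProbabilityMeasure P] (S : Ω → ℕ) (A V : ℕ → Ω → ℝ)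
    (n : ℕ) (ω : Ω) : Measure EventType :=
  condDistrib (eventType S A V n) (fun ω' => (history S A V n ω', interTime S A V n ω')) P
    (history S A V n ω, interTime S A V n ω)

open Classical in
/-- The rate parameter of an exponential distribution (and `0` for any other measure). -/
def exponentialRate (μ : Measure ℝ) : ℝ :=
  if h : ∃ r : ℝ, 0 < r ∧ μ = expMeasure r then h.choose else 0

/-- The average event-type log-loss of the oracle over the first `N` events. -/
def avgEventLoss (P : Measure Ω) [IsProbabilityMeasure P] (S : Ω → ℕ) (A V : ℕ → Ω → ℝ)
    (N : ℕ) (ω : Ω) : ℝ :=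
  -((1 / (N : ℝ)) * ∑ n ∈ Finset.range N,
    Real.log ((eventLaw P S A V n ω).real {eventType S A V n ω}))

/-- The average squared-error inter-event time loss of the oracle over the first `N` events. -/
def avgTimeLoss (P : Measure Ω) [IsProbabilityMeasure P] (S : Ω → ℕ) (A V : ℕ → Ω → ℝ)
    (N : ℕ) (ω : Ω) : ℝ :=
  (1 / (N : ℝ)) * ∑ n ∈ Finset.range N,
    (1 / exponentialRate (timeLaw P S A V n ω) - interTime S A V n ω) ^ 2

end MM1

end

open scoped ENNReal

noncomputable section

namespace MM1

/-! Exponential clocks are memoryless. In a race of two of them, the time of the first ring, the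
identity of the winner and the residual time of the loser are independent, and the residual is again
exponential with its old rate. So after any event the residual clocks are independent of the
observed history and distributed as at time 0 (`lintegral_step`, and `map_history_clocks` by
induction). The queue length is a function of the history. Hence, given the history, the next time
and type are independent: an arrival at rate `lam` if the server is idle; if it is busy, rate `lam +
nu` and an arrival with probability `lam / (lam + nu)`.

Each loss is then a function of the queue length and of the next event. Minus its conditional mean,
it has orthogonal increments, whose averages vanish almost surely (`ae_tendsto_average`). The
conditional mean only depends on whether the server is idle, so the limits are fixed by the long-run
fraction `π` of events that find it idle.

No ergodic theorem is needed for `π`. If `Z` counts idle starts, `c = (lam - nu) / (lam + nu)` is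
the busy drift and `M` the centred walk, then `q N = q 0 + Z N + c (N - Z N) + M N` with `M N =
o(N)`. For `c ≤ 0` a reflection bound gives `q N = o(N)`, hence `π = -c / (1 - c)`. For `c ≥ 0` the
balance at an idle instant bounds `Z N` by the fluctuations of `M`, hence `π = 0`. -/

/-! ### Exponential clocks and their race -/

/-- Positivity of a rate is carried by `Fact`, so that instance search finds the probability
measures built from it. -/
instance isProbabilityMeasure_expMeasure_of_fact (r : ℝ) [hr : Fact (0 < r)] :
    IsProbabilityMeasure (expMeasure r) :=
  isProbabilityMeasure_expMeasure hr.out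

instance nullSingletonClass_expMeasure (r : ℝ) : NullSingletonClass (expMeasure r) :=
  inferInstanceAs (NullSingletonClass (volume.withDensity (exponentialPDF r)))

lemma measurable_exponentialPDF (r : ℝ) : Measurable (exponentialPDF r) :=
  (measurable_exponentialPDFReal r).ennreal_ofReal

lemma lintegral_expMeasure (r : ℝ) {f : ℝ → ℝ≥0∞} (hf : Measurable f) :
    ∫⁻ x, f x ∂expMeasure r = ∫⁻ x, exponentialPDF r x * f x := by
  have h : expMeasure r = volume.withDensity (exponentialPDF r) := rfl
  rw [h, lintegral_withDensity_eq_lintegral_mul _ (measurable_exponentialPDF r) hf]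
  rfl

lemma ae_nonneg_expMeasure (r : ℝ) : ∀ᵐ x ∂expMeasure r, 0 ≤ x := by
  have h : expMeasure r = volume.withDensity (exponentialPDF r) := rfl
  rw [h, ae_withDensity_iff (measurable_exponentialPDF r)]
  refine ae_of_all _ fun x hx => ?_
  by_contra hlt
  exact hx (exponentialPDF_of_neg (not_le.1 hlt))

/-- The exponential distribution is memoryless. -/
lemma lintegral_expMeasure_excess {r : ℝ} {f : ℝ → ℝ≥0∞} (hf : Measurable f)
    {x : ℝ} (hx : 0 ≤ x) :
    ∫⁻ y, (if x ≤ y then f (y - x) else 0) ∂expMeasure r =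
      ENNReal.ofReal (Real.exp (-(r * x))) * ∫⁻ w, f w ∂expMeasure r := by
  have hmeas : Measurable fun y : ℝ => if x ≤ y then f (y - x) else 0 :=
    Measurable.ite measurableSet_Ici (by fun_prop) measurable_const
  rw [lintegral_expMeasure r hmeas, lintegral_expMeasure r hf,
    ← lintegral_const_mul _ (by exact (measurable_exponentialPDF r).mul hf),
    ← lintegral_add_right_eq_self _ x]
  refine lintegral_congr fun w => ?_
  by_cases hw : 0 ≤ w
  · have h1 : x ≤ w + x := by linarith
    simp only [h1, if_true, add_sub_cancel_right]
    rw [exponentialPDF_of_nonneg hw, exponentialPDF_of_nonneg (by linarith), ← mul_assoc,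
      ← ENNReal.ofReal_mul (Real.exp_pos _).le]
    congr 2
    rw [mul_left_comm, ← Real.exp_add]
    ring_nf
  · have h1 : ¬ x ≤ w + x := by linarith
    simp [h1, exponentialPDF_of_neg (not_le.1 hw)]

/-- Ties are null. The strict form serves departures, since `step` resolves a tie as an arrival. -/
lemma lintegral_expMeasure_excess_of_lt {r : ℝ} {f : ℝ → ℝ≥0∞} (hf : Measurable f)
    {x : ℝ} (hx : 0 ≤ x) :
    ∫⁻ y, (if x < y then f (y - x) else 0) ∂expMeasure r =
      ENNReal.ofReal (Real.exp (-(r * x))) * ∫⁻ w, f w ∂expMeasure r := by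
  rw [← lintegral_expMeasure_excess hf hx]
  refine lintegral_congr_ae ?_
  filter_upwards [Measure.ae_ne (expMeasure r) x] with y hy
  have : x < y ↔ x ≤ y := ⟨le_of_lt, fun h => lt_of_le_of_ne h (Ne.symm hy)⟩
  simp only [this]

/-- The weight `exp (-(b * x))`, the chance that a rival clock of rate `b` is still running at `x`,
tilts the density of rate `a` into `a / (a + b)` times that of rate `a + b`. -/
lemma lintegral_expMeasure_mul_exp {a b : ℝ} (ha : 0 < a) (hb : 0 < b) {f : ℝ → ℝ≥0∞}
    (hf : Measurable f) :
    ∫⁻ x, ENNReal.ofReal (Real.exp (-(b * x))) * f x ∂expMeasure a =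
      ENNReal.ofReal (a / (a + b)) * ∫⁻ x, f x ∂expMeasure (a + b) := by
  rw [lintegral_expMeasure a (by fun_prop), lintegral_expMeasure _ hf,
    ← lintegral_const_mul _ (by exact (measurable_exponentialPDF _).mul hf)]
  refine lintegral_congr fun x => ?_
  by_cases hx : 0 ≤ x
  · rw [exponentialPDF_of_nonneg hx, exponentialPDF_of_nonneg hx, ← mul_assoc, ← mul_assoc,
      ← ENNReal.ofReal_mul (by positivity), ← ENNReal.ofReal_mul (by positivity)]
    congr 2
    rw [mul_assoc, ← Real.exp_add]
    field_simp
    ring_nf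
  · simp [exponentialPDF_of_neg (not_le.1 hx)]

/-- In a race of two independent exponential clocks, the time of the first ring, the identity of
the first clock and the residual time of the other clock are independent. -/
lemma lintegral_race {a b : ℝ} [Fact (0 < a)] [Fact (0 < b)]
    {f : ℝ → ℝ → ℝ≥0∞} (hf : Measurable (Function.uncurry f)) :
    ∫⁻ x, ∫⁻ y, (if x ≤ y then f x (y - x) else 0) ∂expMeasure b ∂expMeasure a =
      ENNReal.ofReal (a / (a + b)) *
        ∫⁻ t, ∫⁻ w, f t w ∂expMeasure b ∂expMeasure (a + b) := by
  have ha : 0 < a := Fact.out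
  have hb : 0 < b := Fact.out
  rw [← lintegral_expMeasure_mul_exp ha hb (by exact Measurable.lintegral_prod_right' hf)]
  refine lintegral_congr_ae ?_
  filter_upwards [ae_nonneg_expMeasure a] with x hx
  exact lintegral_expMeasure_excess (f := f x) (by exact hf.comp measurable_prodMk_left) hx

lemma lintegral_race_of_lt {a b : ℝ} [Fact (0 < a)] [Fact (0 < b)]
    {f : ℝ → ℝ → ℝ≥0∞} (hf : Measurable (Function.uncurry f)) :
    ∫⁻ x, ∫⁻ y, (if x < y then f x (y - x) else 0) ∂expMeasure b ∂expMeasure a =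
      ENNReal.ofReal (a / (a + b)) *
        ∫⁻ t, ∫⁻ w, f t w ∂expMeasure b ∂expMeasure (a + b) := by
  have ha : 0 < a := Fact.out
  have hb : 0 < b := Fact.out
  rw [← lintegral_expMeasure_mul_exp ha hb (by exact Measurable.lintegral_prod_right' hf)]
  refine lintegral_congr_ae ?_
  filter_upwards [ae_nonneg_expMeasure a] with x hx
  exact lintegral_expMeasure_excess_of_lt (f := f x) (by exact hf.comp measurable_prodMk_left) hx

/-! ### Sequences of independent clocks -/

/-- Put a time in front of a sequence of times. -/
def cons (x : ℝ) (u : ℕ → ℝ) : ℕ → ℝ := fun n => Nat.casesOn n x u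

@[simp] lemma cons_zero (x : ℝ) (u : ℕ → ℝ) : cons x u 0 = x := rfl

@[simp] lemma cons_succ (x : ℝ) (u : ℕ → ℝ) (n : ℕ) : cons x u (n + 1) = u n := rfl

@[simp] lemma shift_cons (x : ℝ) (u : ℕ → ℝ) : shift (cons x u) = u := rfl

@[simp] lemma elapse_cons (t x : ℝ) (u : ℕ → ℝ) : elapse t (cons x u) = cons (x - t) u := by
  funext n
  cases n <;> simp [elapse]

lemma measurable_cons : Measurable fun p : ℝ × (ℕ → ℝ) => cons p.1 p.2 := by
  refine measurable_pi_lambda _ fun n => ?_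
  cases n with
  | zero => exact measurable_fst
  | succ n => exact (measurable_pi_apply n).comp measurable_snd

/-- The law of a sequence of independent exponential times of rate `r`. -/
def clockLaw (r : ℝ) [Fact (0 < r)] : Measure (ℕ → ℝ) :=
  Measure.infinitePi fun _ : ℕ => expMeasure r

instance isProbabilityMeasure_clockLaw (r : ℝ) [Fact (0 < r)] :
    IsProbabilityMeasure (clockLaw r) := by
  unfold clockLaw
  infer_instance

/-- A product measure is determined by its finite boxes, and a box over an initial range splits at
coordinate 0. This lets the current clock be peeled off, and a fresh one be put back. -/
lemma map_cons_clockLaw (r : ℝ) [Fact (0 < r)] :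
    ((expMeasure r).prod (clockLaw r)).map (fun p => cons p.1 p.2) = clockLaw r := by
  classical
  refine Measure.eq_infinitePi _ fun s t ht => ?_
  obtain ⟨N, hN⟩ := s.exists_nat_subset_range
  -- Padding with `Set.univ` turns the box over `s` into one over `range (N + 1)`, which always
  -- contains 0.
  set t' : ℕ → Set ℝ := fun i => if i ∈ s then t i else Set.univ with ht'
  have hmt' : ∀ i, MeasurableSet (t' i) := fun i => by
    by_cases h : i ∈ s <;> simp [ht', h, ht]
  have hpi : (s : Set ℕ).pi t = (Finset.range (N + 1) : Set ℕ).pi t' := by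
    ext x
    simp only [Set.mem_pi, Finset.mem_coe, ht']
    constructor
    · intro h i _
      by_cases his : i ∈ s <;> simp [his, h]
    · intro h i his
      have := h i (Finset.range_mono (Nat.le_succ N) (hN his))
      simpa [his] using this
  have hprod : ∏ i ∈ s, expMeasure r (t i) = ∏ i ∈ Finset.range (N + 1), expMeasure r (t' i) := by
    rw [← Finset.prod_subset (hN.trans (Finset.range_mono (Nat.le_succ N)))]
    · exact Finset.prod_congr rfl fun i hi => by simp [ht', hi]
    · intro i _ hi
      simp [ht', hi]
  have hpre : (fun p : ℝ × (ℕ → ℝ) => cons p.1 p.2) ⁻¹' (Finset.range (N + 1) : Set ℕ).pi t' =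
      t' 0 ×ˢ (Finset.range N : Set ℕ).pi fun i => t' (i + 1) := by
    ext p
    simp only [Set.mem_preimage, Set.mem_pi, Finset.mem_coe, Finset.mem_range, Set.mem_prod]
    constructor
    · exact fun h => ⟨h 0 (Nat.succ_pos N), fun i hi => h (i + 1) (Nat.succ_lt_succ hi)⟩
    · rintro ⟨h0, h⟩ i hi
      cases i with
      | zero => exact h0
      | succ i => exact h i (Nat.lt_of_succ_lt_succ hi)
  rw [hpi, hprod, Measure.map_apply measurable_cons
    (MeasurableSet.pi (Finset.countable_toSet _) fun i _ => hmt' i), hpre, Measure.prod_prod,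
    clockLaw, Measure.infinitePi_pi _ (fun i _ => hmt' (i + 1)), Finset.prod_range_succ', mul_comm]

lemma lintegral_clockLaw (r : ℝ) [Fact (0 < r)] {f : (ℕ → ℝ) → ℝ≥0∞} (hf : Measurable f) :
    ∫⁻ a, f a ∂clockLaw r = ∫⁻ x, ∫⁻ u, f (cons x u) ∂clockLaw r ∂expMeasure r := by
  conv_lhs => rw [← map_cons_clockLaw r]
  rw [lintegral_map hf measurable_cons,
    lintegral_prod _ (by exact (hf.comp measurable_cons).aemeasurable)]

/-! ### One step of the queue -/

section

/-- The total rate of the clocks that run while there are `q` customers in the system. -/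
def eventRate (lam nu : ℝ) (q : ℕ) : ℝ := if q = 0 then lam else lam + nu

/-- The law of the type of the next event while there are `q` customers in the system. -/
def markLaw (lam nu : ℝ) (q : ℕ) : Measure EventType :=
  if q = 0 then Measure.dirac EventType.arrival
  else ENNReal.ofReal (lam / (lam + nu)) • Measure.dirac EventType.arrival +
    ENNReal.ofReal (nu / (lam + nu)) • Measure.dirac EventType.departure

lemma lintegral_markLaw_succ (lam nu : ℝ) (q : ℕ) (f : EventType → ℝ≥0∞) :
    ∫⁻ e, f e ∂markLaw lam nu (q + 1) = ENNReal.ofReal (lam / (lam + nu)) * f .arrival +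
      ENNReal.ofReal (nu / (lam + nu)) * f .departure := by
  simp [markLaw, lintegral_add_measure, lintegral_smul_measure]

instance fact_add_pos (a b : ℝ) [ha : Fact (0 < a)] [hb : Fact (0 < b)] : Fact (0 < a + b) :=
  ⟨add_pos ha.out hb.out⟩

variable (lam nu : ℝ) [Fact (0 < lam)] [Fact (0 < nu)]

instance fact_eventRate_pos (q : ℕ) : Fact (0 < eventRate lam nu q) := by
  unfold eventRate
  split_ifs <;> infer_instance

instance isProbabilityMeasure_markLaw (q : ℕ) : IsProbabilityMeasure (markLaw lam nu q) := by
  have ha : 0 < lam := Fact.out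
  have hb : 0 < nu := Fact.out
  unfold markLaw
  split_ifs
  · infer_instance
  · constructor
    simp only [Measure.coe_add, Measure.coe_smul, Pi.add_apply, Pi.smul_apply, measure_univ,
      smul_eq_mul, mul_one]
    rw [← ENNReal.ofReal_add (by positivity) (by positivity), ← add_div,
      div_self (by positivity), ENNReal.ofReal_one]

/-- The joint law of the time until the next event and of its type while there are `q` customers
in the system. -/
def stepLaw (q : ℕ) : Measure (ℝ × EventType) :=
  (expMeasure (eventRate lam nu q)).prod (markLaw lam nu q)

instance isProbabilityMeasure_stepLaw (q : ℕ) : IsProbabilityMeasure (stepLaw lam nu q) := by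
  unfold stepLaw
  infer_instance

lemma measurable_shift : Measurable shift :=
  measurable_pi_lambda _ fun k => measurable_pi_apply (k + 1)

lemma measurable_elapse : Measurable fun p : ℝ × (ℕ → ℝ) => elapse p.1 p.2 := by
  refine measurable_pi_lambda _ fun k => ?_
  cases k with
  | zero =>
    have : (fun p : ℝ × (ℕ → ℝ) => elapse p.1 p.2 0) = fun p => p.2 0 - p.1 := by
      funext p
      simp [elapse]
    rw [this]
    fun_prop
  | succ k =>
    have : (fun p : ℝ × (ℕ → ℝ) => elapse p.1 p.2 (k + 1)) = fun p => p.2 (k + 1) := by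
      funext p
      simp [elapse]
    rw [this]
    fun_prop

lemma measurableSet_arrival_next :
    MeasurableSet {z : SimState | z.1 = 0 ∨ z.2.1 0 ≤ z.2.2 0} :=
  MeasurableSet.union (measurable_fst (measurableSet_singleton 0))
    (measurableSet_le (f := fun z : SimState => z.2.1 0) (g := fun z : SimState => z.2.2 0)
      (by fun_prop) (by fun_prop))

lemma measurable_nextEvent : Measurable nextEvent :=
  Measurable.ite measurableSet_arrival_next measurable_const measurable_const

lemma measurable_nextTime : Measurable nextTime :=
  Measurable.ite measurableSet_arrival_next (by fun_prop) (by fun_prop)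

lemma measurable_step : Measurable step := by
  refine Measurable.ite (measurable_fst (measurableSet_singleton 0)) ?_
    (Measurable.ite (measurableSet_le (f := fun z : SimState => z.2.1 0)
      (g := fun z : SimState => z.2.2 0) (by fun_prop) (by fun_prop)) ?_ ?_)
  · exact measurable_const.prodMk ((measurable_shift.comp (by fun_prop)).prodMk (by fun_prop))
  · exact Measurable.prodMk (by fun_prop) ((measurable_shift.comp (by fun_prop)).prodMk
      (measurable_elapse.comp (Measurable.prodMk (by fun_prop) (by fun_prop))))
  · exact Measurable.prodMk ((measurable_of_countable fun q : ℕ => q - 1).comp measurable_fst)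
      ((measurable_elapse.comp (Measurable.prodMk (by fun_prop) (by fun_prop))).prodMk
        (measurable_shift.comp (by fun_prop)))

/-- The joint law of the arrival and of the service clocks. -/
def clocksLaw : Measure ((ℕ → ℝ) × (ℕ → ℝ)) := (clockLaw lam).prod (clockLaw nu)

instance isProbabilityMeasure_clocksLaw : IsProbabilityMeasure (clocksLaw lam nu) := by
  unfold clocksLaw
  infer_instance

/-- The two current clocks are integrated outermost, in the shape of a race, and the future clocks
inside. -/
lemma lintegral_clocksLaw {f : (ℕ → ℝ) × (ℕ → ℝ) → ℝ≥0∞} (hf : Measurable f) :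
    ∫⁻ w, f w ∂clocksLaw lam nu = ∫⁻ x, ∫⁻ y, ∫⁻ u, ∫⁻ v, f (cons x u, cons y v)
      ∂clockLaw nu ∂clockLaw lam ∂expMeasure nu ∂expMeasure lam := by
  have hg : Measurable fun p : (ℝ × ℝ) × (ℕ → ℝ) × (ℕ → ℝ) =>
      f (cons p.1.1 p.2.1, cons p.1.2 p.2.2) :=
    hf.comp ((measurable_cons.comp (by fun_prop : Measurable fun p :
      (ℝ × ℝ) × (ℕ → ℝ) × (ℕ → ℝ) => (p.1.1, p.2.1))).prodMk
      (measurable_cons.comp (by fun_prop : Measurable fun p :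
      (ℝ × ℝ) × (ℕ → ℝ) × (ℕ → ℝ) => (p.1.2, p.2.2))))
  unfold clocksLaw
  rw [lintegral_prod _ hf.aemeasurable, lintegral_clockLaw lam (by
    exact Measurable.lintegral_prod_right' hf)]
  refine lintegral_congr fun x => ?_
  have h1 : ∀ u, ∫⁻ s, f (cons x u, s) ∂clockLaw nu =
      ∫⁻ y, ∫⁻ v, f (cons x u, cons y v) ∂clockLaw nu ∂expMeasure nu := fun u =>
    lintegral_clockLaw nu (by exact hf.comp measurable_prodMk_left)
  simp_rw [h1]
  rw [lintegral_lintegral_swap]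
  have h2 : Measurable fun r : ((ℕ → ℝ) × ℝ) × (ℕ → ℝ) => f (cons x r.1.1, cons r.1.2 r.2) :=
    hg.comp (by fun_prop : Measurable fun r : ((ℕ → ℝ) × ℝ) × (ℕ → ℝ) =>
      ((x, r.1.2), (r.1.1, r.2)))
  exact (Measurable.lintegral_prod_right' h2).aemeasurable

/-- One step of the queue: whatever the number of customers, the residual clocks are independent
of the time and of the type of the next event, and have the same law as before. -/
lemma lintegral_step (q : ℕ) {f : ℝ × EventType → (ℕ → ℝ) × (ℕ → ℝ) → ℝ≥0∞}
    (hf : Measurable (Function.uncurry f)) :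
    ∫⁻ w, f (nextTime (q, w), nextEvent (q, w)) (step (q, w)).2 ∂clocksLaw lam nu =
      ∫⁻ z, ∫⁻ w, f z w ∂clocksLaw lam nu ∂stepLaw lam nu q := by
  have hstep : Measurable fun w : (ℕ → ℝ) × (ℕ → ℝ) =>
      f (nextTime (q, w), nextEvent (q, w)) (step (q, w)).2 := by
    have h0 : Measurable fun w : (ℕ → ℝ) × (ℕ → ℝ) => ((q, w) : SimState) := measurable_prodMk_left
    exact hf.comp (((measurable_nextTime.comp h0).prodMk (measurable_nextEvent.comp h0)).prodMk
      (measurable_snd.comp (measurable_step.comp h0)))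
  have hz : Measurable fun z : ℝ × EventType => ∫⁻ w, f z w ∂clocksLaw lam nu :=
    Measurable.lintegral_prod_right' hf
  have hfz : ∀ z, Measurable (f z) := fun z => hf.comp measurable_prodMk_left
  rw [lintegral_clocksLaw lam nu hstep, stepLaw, lintegral_prod _ hz.aemeasurable]
  cases q with
  -- With an idle server there is no race: the arrival clock is consumed and the service sequence is
  -- untouched.
  | zero =>
    simp only [nextTime, nextEvent, step, eventRate, markLaw, true_or, if_true, cons_zero,
      shift_cons, lintegral_dirac]
    refine lintegral_congr fun x => ?_
    have h1 : ∫⁻ w, f (x, EventType.arrival) w ∂clocksLaw lam nu =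
        ∫⁻ u, ∫⁻ s, f (x, EventType.arrival) (u, s) ∂clockLaw nu ∂clockLaw lam :=
      lintegral_prod _ (hfz _).aemeasurable
    have h2 : ∀ u, ∫⁻ s, f (x, EventType.arrival) (u, s) ∂clockLaw nu =
      ∫⁻ y, ∫⁻ v, f (x, EventType.arrival) (u, cons y v) ∂clockLaw nu ∂expMeasure nu := fun u =>
      lintegral_clockLaw nu (by exact (hfz _).comp measurable_prodMk_left)
    rw [h1]
    simp_rw [h2]
    rw [lintegral_lintegral_swap]
    have h3 : Measurable fun r : (ℝ × (ℕ → ℝ)) × (ℕ → ℝ) =>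
        f (x, EventType.arrival) (r.1.2, cons r.1.1 r.2) :=
      (hfz _).comp (Measurable.prodMk (by fun_prop) (measurable_cons.comp
        (by fun_prop : Measurable fun r : (ℝ × (ℕ → ℝ)) × (ℕ → ℝ) => (r.1.1, r.2))))
    exact (Measurable.lintegral_prod_right' h3).aemeasurable
  | succ q =>
    have hrate : eventRate lam nu (q + 1) = lam + nu := by simp [eventRate]
    simp only [lintegral_markLaw_succ, hrate]
    -- `w` is the residual time of the losing clock: it heads the loser's sequence, while the winner
    -- keeps only its tail.
    set g : EventType → ℝ → ℝ → ℝ≥0∞ := fun e t w => match e with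
      | .arrival => ∫⁻ u, ∫⁻ v, f (t, .arrival) (u, cons w v) ∂clockLaw nu ∂clockLaw lam
      | .departure => ∫⁻ u, ∫⁻ v, f (t, .departure) (cons w u, v) ∂clockLaw nu ∂clockLaw lam
      with hg
    have hgm1 : Measurable (Function.uncurry (g .arrival)) := by
      have : Measurable fun r : ((ℝ × ℝ) × (ℕ → ℝ)) × (ℕ → ℝ) =>
          f (r.1.1.1, .arrival) (r.1.2, cons r.1.1.2 r.2) :=
        hf.comp (Measurable.prodMk (by fun_prop) (Measurable.prodMk (by fun_prop)
          (measurable_cons.comp (by fun_prop : Measurable fun r :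
            ((ℝ × ℝ) × (ℕ → ℝ)) × (ℕ → ℝ) => (r.1.1.2, r.2)))))
      exact Measurable.lintegral_prod_right' (Measurable.lintegral_prod_right' this)
    have hgm2 : Measurable (Function.uncurry (g .departure)) := by
      have : Measurable fun r : ((ℝ × ℝ) × (ℕ → ℝ)) × (ℕ → ℝ) =>
          f (r.1.1.1, .departure) (cons r.1.1.2 r.1.2, r.2) :=
        hf.comp (Measurable.prodMk (by fun_prop) (Measurable.prodMk
          (measurable_cons.comp (by fun_prop : Measurable fun r :
            ((ℝ × ℝ) × (ℕ → ℝ)) × (ℕ → ℝ) => (r.1.1.2, r.1.2))) (by fun_prop)))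
      exact Measurable.lintegral_prod_right' (Measurable.lintegral_prod_right' this)
    have hsplit : ∀ x y, ∫⁻ u, ∫⁻ v, f (nextTime (q + 1, cons x u, cons y v),
        nextEvent (q + 1, cons x u, cons y v)) (step (q + 1, cons x u, cons y v)).2
          ∂clockLaw nu ∂clockLaw lam =
        (if x ≤ y then g .arrival x (y - x) else 0) +
          (if y < x then g .departure y (x - y) else 0) := by
      intro x y
      by_cases h : x ≤ y
      · simp [nextTime, nextEvent, step, h, hg, not_lt.2 h]
      · simp [nextTime, nextEvent, step, h, hg]
    have hm1 : Measurable fun p : ℝ × ℝ => if p.1 ≤ p.2 then g .arrival p.1 (p.2 - p.1) else 0 :=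
      Measurable.ite (measurableSet_le measurable_fst measurable_snd)
        (hgm1.comp (by fun_prop : Measurable fun p : ℝ × ℝ => (p.1, p.2 - p.1))) measurable_const
    have hm2 : Measurable fun p : ℝ × ℝ => if p.2 < p.1 then g .departure p.2 (p.1 - p.2) else 0 :=
      Measurable.ite (measurableSet_lt measurable_snd measurable_fst)
        (hgm2.comp (by fun_prop : Measurable fun p : ℝ × ℝ => (p.2, p.1 - p.2))) measurable_const
    simp_rw [hsplit]
    have hadd : ∀ x, ∫⁻ y, ((if x ≤ y then g .arrival x (y - x) else 0) +
          (if y < x then g .departure y (x - y) else 0)) ∂expMeasure nu =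
        ∫⁻ y, (if x ≤ y then g .arrival x (y - x) else 0) ∂expMeasure nu +
          ∫⁻ y, (if y < x then g .departure y (x - y) else 0) ∂expMeasure nu := fun x =>
      lintegral_add_left (by exact hm1.comp measurable_prodMk_left) _
    simp_rw [hadd]
    -- A departure is a race won by the service clock, hence the swap of integrals and the later
    -- `add_comm nu lam`.
    rw [lintegral_add_left (by exact Measurable.lintegral_prod_right' hm1), lintegral_race hgm1,
      lintegral_lintegral_swap (f := fun x y => if y < x then g .departure y (x - y) else 0)
        (by exact hm2.aemeasurable), lintegral_race_of_lt hgm2]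
    rw [lintegral_add_left (by
        exact (hz.comp (by fun_prop : Measurable fun t : ℝ => (t, EventType.arrival))).const_mul _),
      lintegral_const_mul _ (by
        exact hz.comp (by fun_prop : Measurable fun t : ℝ => (t, EventType.arrival))),
      lintegral_const_mul _ (by
        exact hz.comp (by fun_prop : Measurable fun t : ℝ => (t, EventType.departure))),
      add_comm nu lam]
    -- By memorylessness the residual has the law of a fresh clock, so consing it onto its tail
    -- restores `clockLaw`.
    congr 2
    · refine lintegral_congr fun t => ?_
      have h1 : ∫⁻ w, f (t, EventType.arrival) w ∂clocksLaw lam nu =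
          ∫⁻ u, ∫⁻ s, f (t, EventType.arrival) (u, s) ∂clockLaw nu ∂clockLaw lam :=
        lintegral_prod _ (hfz _).aemeasurable
      have h2 : ∀ u, ∫⁻ s, f (t, EventType.arrival) (u, s) ∂clockLaw nu =
        ∫⁻ y, ∫⁻ v, f (t, EventType.arrival) (u, cons y v) ∂clockLaw nu ∂expMeasure nu := fun u =>
        lintegral_clockLaw nu (by exact (hfz _).comp measurable_prodMk_left)
      rw [h1]
      simp_rw [h2]
      have h3 : Measurable fun r : ((ℕ → ℝ) × ℝ) × (ℕ → ℝ) =>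
          f (t, EventType.arrival) (r.1.1, cons r.1.2 r.2) :=
        (hfz _).comp (Measurable.prodMk (by fun_prop) (measurable_cons.comp
          (by fun_prop : Measurable fun r : ((ℕ → ℝ) × ℝ) × (ℕ → ℝ) => (r.1.2, r.2))))
      exact (lintegral_lintegral_swap
        (Measurable.lintegral_prod_right' (ν := clockLaw nu) h3).aemeasurable).symm
    · refine lintegral_congr fun t => ?_
      have h1 : ∫⁻ w, f (t, EventType.departure) w ∂clocksLaw lam nu =
          ∫⁻ a, ∫⁻ v, f (t, EventType.departure) (a, v) ∂clockLaw nu ∂clockLaw lam :=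
        lintegral_prod _ (hfz _).aemeasurable
      rw [h1]
      exact (lintegral_clockLaw lam
        (Measurable.lintegral_prod_right' (ν := clockLaw nu) (hfz (t, .departure)))).symm

end

/-! ### Histories and the law of the residual clocks -/

section

/-- Observed histories of length `n`. -/
abbrev History (n : ℕ) : Type := ℕ × (Fin n → ℝ × EventType)

/-- The number of customers after an event. -/
def nextLength (q : ℕ) : EventType → ℕ
  | .arrival => q + 1
  | .departure => q - 1

lemma fst_step (z : SimState) : (step z).1 = nextLength z.1 (nextEvent z) := by
  unfold step nextEvent
  split_ifs <;> grind [nextLength]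

/-- Forget the last event of a history. -/
def historyInit {n : ℕ} (h : History (n + 1)) : History n := (h.1, fun i => h.2 i.castSucc)

/-- Append an event to a history. -/
def historySnoc {n : ℕ} (h : History n) (z : ℝ × EventType) : History (n + 1) :=
  (h.1, Fin.snoc (α := fun _ => ℝ × EventType) h.2 z)

/-- The number of customers after the events of a history. -/
def queueLength : (n : ℕ) → History n → ℕ
  | 0, h => h.1
  | n + 1, h => nextLength (queueLength n (historyInit h)) (h.2 (Fin.last n)).2

lemma measurable_init (n : ℕ) : Measurable (historyInit (n := n)) :=
  measurable_fst.prodMk (measurable_pi_lambda _ fun i =>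
    (measurable_pi_apply i.castSucc).comp measurable_snd)

lemma measurable_snoc (n : ℕ) :
    Measurable fun p : History n × (ℝ × EventType) => historySnoc p.1 p.2 := by
  refine (measurable_fst.comp measurable_fst).prodMk (measurable_pi_lambda _ fun i => ?_)
  refine Fin.lastCases ?_ (fun j => ?_) i
  · simpa using measurable_snd
  · have h : Measurable fun p : History n × (ℝ × EventType) => p.1.2 j :=
      (measurable_pi_apply j).comp (measurable_snd.comp measurable_fst)
    simpa using h

lemma measurable_queueLength (n : ℕ) : Measurable (queueLength n) := by
  induction n with
  | zero => exact measurable_fst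
  | succ n ih =>
    have h1 : Measurable fun p : ℕ × EventType => nextLength p.1 p.2 := measurable_of_countable _
    exact h1.comp ((ih.comp (measurable_init n)).prodMk
      (measurable_snd.comp ((measurable_pi_apply (Fin.last n)).comp measurable_snd)))

/-- The conditional law of the next inter-event time and event type given the history. -/
def stepKernel (lam nu : ℝ) (n : ℕ) : Kernel (History n) (ℝ × EventType) :=
  (Kernel.ofFunOfCountable (stepLaw lam nu)).comap (queueLength n) (measurable_queueLength n)

lemma stepKernel_apply (lam nu : ℝ) (n : ℕ) (h : History n) :
    stepKernel lam nu n h = stepLaw lam nu (queueLength n h) := rfl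

section Paths

variable {Ω : Type*} (S : Ω → ℕ) (A V : ℕ → Ω → ℝ)

lemma simState_succ (n : ℕ) (ω : Ω) :
    simState S A V (n + 1) ω = step (simState S A V n ω) :=
  Function.iterate_succ_apply' _ _ _

lemma history_succ (n : ℕ) (ω : Ω) : history S A V (n + 1) ω =
    historySnoc (history S A V n ω) (interTime S A V n ω, eventType S A V n ω) := by
  refine Prod.ext rfl (funext fun i => ?_)
  refine Fin.lastCases ?_ (fun j => ?_) i
  · simp [history, historySnoc]
  · simp [history, historySnoc]

lemma init_history (n : ℕ) (ω : Ω) : historyInit (history S A V (n + 1) ω) = history S A V n ω := rfl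

/-- The queue length is observable, which is what allows `stepKernel` to be a kernel on histories.
-/
lemma queueLength_history (n : ℕ) (ω : Ω) :
    queueLength n (history S A V n ω) = (simState S A V n ω).1 := by
  induction n with
  | zero => rfl
  | succ n ih =>
    rw [queueLength, init_history, ih, simState_succ, fst_step]
    rfl

end Paths

section Measurability

variable {Ω : Type*} [MeasurableSpace Ω] {S : Ω → ℕ} {A V : ℕ → Ω → ℝ}

lemma measurable_simState (hS : Measurable S) (hA : ∀ k, Measurable (A k))
    (hV : ∀ k, Measurable (V k)) (n : ℕ) : Measurable (simState S A V n) :=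
  (measurable_step.iterate n).comp
    (hS.prodMk ((measurable_pi_lambda _ hA).prodMk (measurable_pi_lambda _ hV)))

lemma measurable_interTime (hS : Measurable S) (hA : ∀ k, Measurable (A k))
    (hV : ∀ k, Measurable (V k)) (n : ℕ) : Measurable (interTime S A V n) :=
  measurable_nextTime.comp (measurable_simState hS hA hV n)

lemma measurable_eventType (hS : Measurable S) (hA : ∀ k, Measurable (A k))
    (hV : ∀ k, Measurable (V k)) (n : ℕ) : Measurable (eventType S A V n) :=
  measurable_nextEvent.comp (measurable_simState hS hA hV n)

lemma measurable_history (hS : Measurable S) (hA : ∀ k, Measurable (A k))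
    (hV : ∀ k, Measurable (V k)) (n : ℕ) : Measurable (history S A V n) :=
  hS.prodMk (measurable_pi_lambda _ fun i =>
    (measurable_interTime hS hA hV i).prodMk (measurable_eventType hS hA hV i))

end Measurability

variable (lam nu : ℝ) [Fact (0 < lam)] [Fact (0 < nu)]

/-- Independence in `IsMM1Queue` is joint over `ℕ ⊕ ℕ`; a box there is the product of its left and
right parts. -/
lemma map_sumElim_clocksLaw : (clocksLaw lam nu).map
      (fun w : (ℕ → ℝ) × (ℕ → ℝ) => (Sum.elim w.1 w.2 : ℕ ⊕ ℕ → ℝ)) =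
    Measure.infinitePi fun i : ℕ ⊕ ℕ => expMeasure (Sum.elim (fun _ => lam) (fun _ => nu) i) := by
  have hm : Measurable fun w : (ℕ → ℝ) × (ℕ → ℝ) => (Sum.elim w.1 w.2 : ℕ ⊕ ℕ → ℝ) := by
    refine measurable_pi_lambda _ fun i => ?_
    cases i
    · exact (measurable_pi_apply _).comp measurable_fst
    · exact (measurable_pi_apply _).comp measurable_snd
  have hfact : ∀ i : ℕ ⊕ ℕ, Fact (0 < Sum.elim (fun _ : ℕ => lam) (fun _ : ℕ => nu) i) := by
    rintro (i | i)
    · exact inferInstanceAs (Fact (0 < lam))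
    · exact inferInstanceAs (Fact (0 < nu))
  refine Measure.eq_infinitePi _ fun s t ht => ?_
  have hpre : (fun w : (ℕ → ℝ) × (ℕ → ℝ) => (Sum.elim w.1 w.2 : ℕ ⊕ ℕ → ℝ)) ⁻¹' (s : Set _).pi t =
      ((s.toLeft : Set ℕ).pi fun i => t (Sum.inl i)) ×ˢ
        ((s.toRight : Set ℕ).pi fun i => t (Sum.inr i)) := by
    ext w
    simp [Set.mem_pi]
  rw [Measure.map_apply hm (MeasurableSet.pi (Finset.countable_toSet _) fun i _ => ht i), hpre,
    clocksLaw, Measure.prod_prod, clockLaw, clockLaw,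
    Measure.infinitePi_pi _ (fun i _ => ht _), Measure.infinitePi_pi _ (fun i _ => ht _)]
  conv_rhs => rw [← Finset.toLeft_disjSum_toRight (u := s), Finset.prod_disjSum]
  rfl

instance isMarkovKernel_stepKernel (n : ℕ) : IsMarkovKernel (stepKernel lam nu n) :=
  ⟨fun h => by rw [stepKernel_apply]; infer_instance⟩

variable {Ω : Type*} [MeasurableSpace Ω] {P : Measure Ω}
  {S : Ω → ℕ} {A V : ℕ → Ω → ℝ}

variable {lam nu}

lemma IsMM1Queue.map_clocks (hQ : IsMM1Queue lam nu P S A V) :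
    P.map (fun ω => ((fun k => A k ω), (fun k => V k ω))) = clocksLaw lam nu := by
  have hm : ∀ i, Measurable (Sum.elim A V i) := by
    rintro (i | i)
    · exact hQ.measurable_arrival i
    · exact hQ.measurable_service i
  have hlaw : P.map (fun ω (i : ℕ ⊕ ℕ) => Sum.elim A V i ω) = (clocksLaw lam nu).map
      (fun w : (ℕ → ℝ) × (ℕ → ℝ) => (Sum.elim w.1 w.2 : ℕ ⊕ ℕ → ℝ)) := by
    rw [map_sumElim_clocksLaw, hQ.indep_times.map_fun_eq_infinitePi_map hm]
    congr 1
    funext i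
    cases i
    · exact hQ.law_arrival _
    · exact hQ.law_service _
  have hsplit : Measurable fun x : ℕ ⊕ ℕ → ℝ =>
      ((fun k => x (Sum.inl k)), (fun k => x (Sum.inr k))) := by fun_prop
  have helim : Measurable fun w : (ℕ → ℝ) × (ℕ → ℝ) => (Sum.elim w.1 w.2 : ℕ ⊕ ℕ → ℝ) := by
    refine measurable_pi_lambda _ fun i => ?_
    cases i
    · exact (measurable_pi_apply _).comp measurable_fst
    · exact (measurable_pi_apply _).comp measurable_snd
  have := congrArg (Measure.map fun x : ℕ ⊕ ℕ → ℝ =>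
      ((fun k => x (Sum.inl k)), (fun k => x (Sum.inr k)))) hlaw
  rw [Measure.map_map hsplit (measurable_pi_lambda _ hm), Measure.map_map hsplit helim] at this
  exact this.trans Measure.map_id

variable [IsProbabilityMeasure P]

lemma IsMM1Queue.map_history_zero (hQ : IsMM1Queue lam nu P S A V) :
    P.map (fun ω => (history S A V 0 ω, (simState S A V 0 ω).2)) =
      (P.map (history S A V 0)).prod (clocksLaw lam nu) := by
  have hA : Measurable fun ω => ((fun k => A k ω), (fun k => V k ω)) :=
    (measurable_pi_lambda _ hQ.measurable_arrival).prodMk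
      (measurable_pi_lambda _ hQ.measurable_service)
  have hh : Measurable (history S A V 0) :=
    measurable_history hQ.measurable_init hQ.measurable_arrival hQ.measurable_service 0
  have hφ : Measurable fun s : ℕ => ((s, Fin.elim0) : History 0) := measurable_of_countable _
  have hind := (hQ.indep_init.comp hφ measurable_id)
  have heq : (fun s : ℕ => ((s, Fin.elim0) : History 0)) ∘ S = history S A V 0 := by
    funext ω
    exact Prod.ext rfl (funext fun i => i.elim0)
  rw [heq] at hind
  have := (indepFun_iff_map_prod_eq_prod_map_map hh.aemeasurable hA.aemeasurable).1 hind
  rw [hQ.map_clocks] at this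
  exact this

/-- Once the history is fixed, so is the queue length, and `lintegral_step` applies to the clocks.
The hypothesis `hn` is the induction hypothesis of `map_history_clocks`. -/
lemma IsMM1Queue.map_history_event_clocks (hQ : IsMM1Queue lam nu P S A V) {n : ℕ}
    (hn : P.map (fun ω => (history S A V n ω, (simState S A V n ω).2)) =
      (P.map (history S A V n)).prod (clocksLaw lam nu)) :
    P.map (fun ω => ((history S A V n ω, (interTime S A V n ω, eventType S A V n ω)),
        (simState S A V (n + 1) ω).2)) =
      (P.map (history S A V n) ⊗ₘ stepKernel lam nu n).prod (clocksLaw lam nu) := by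
  have hS := hQ.measurable_init
  have hA := hQ.measurable_arrival
  have hV := hQ.measurable_service
  have hh := measurable_history hS hA hV n
  have hs := measurable_simState hS hA hV
  have : IsProbabilityMeasure (P.map (history S A V n)) :=
    Measure.isProbabilityMeasure_map hh.aemeasurable
  refine Measure.ext_of_lintegral _ fun f hf => ?_
  have hz : Measurable fun p : History n × ((ℕ → ℝ) × (ℕ → ℝ)) =>
      ((queueLength n p.1, p.2) : SimState) :=
    ((measurable_queueLength n).comp measurable_fst).prodMk measurable_snd
  set g : History n × ((ℕ → ℝ) × (ℕ → ℝ)) → ℝ≥0∞ := fun p =>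
    f ((p.1, (nextTime (queueLength n p.1, p.2), nextEvent (queueLength n p.1, p.2))),
      (step (queueLength n p.1, p.2)).2) with hg
  have hgm : Measurable g :=
    hf.comp ((measurable_fst.prodMk ((measurable_nextTime.comp hz).prodMk
      (measurable_nextEvent.comp hz))).prodMk (measurable_snd.comp (measurable_step.comp hz)))
  have hfg : ∀ ω, f ((history S A V n ω, (interTime S A V n ω, eventType S A V n ω)),
      (simState S A V (n + 1) ω).2) = g (history S A V n ω, (simState S A V n ω).2) := fun ω => by
    simp only [hg, queueLength_history, simState_succ]
    rfl
  have hfm : Measurable fun z : History n × (ℝ × EventType) =>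
      ∫⁻ w, f (z, w) ∂clocksLaw lam nu := Measurable.lintegral_prod_right' hf
  have hw : ∀ k, Measurable fun ω => (simState S A V k ω).2 := fun k => measurable_snd.comp (hs k)
  rw [lintegral_map hf ((hh.prodMk ((measurable_interTime hS hA hV n).prodMk
    (measurable_eventType hS hA hV n))).prodMk (hw (n + 1)))]
  simp_rw [hfg]
  rw [← lintegral_map hgm (hh.prodMk (hw n)), hn,
    lintegral_prod _ hgm.aemeasurable, lintegral_prod _ hf.aemeasurable,
    Measure.lintegral_compProd hfm]
  refine lintegral_congr fun h => ?_
  rw [stepKernel_apply]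
  exact lintegral_step lam nu (queueLength n h) (f := fun z w => f ((h, z), w))
    (hf.comp (by fun_prop : Measurable fun p : (ℝ × EventType) × ((ℕ → ℝ) × (ℕ → ℝ)) =>
      ((h, p.1), p.2)))

lemma IsMM1Queue.map_history_event_of_clocks (hQ : IsMM1Queue lam nu P S A V) {n : ℕ}
    (hn : P.map (fun ω => (history S A V n ω, (simState S A V n ω).2)) =
      (P.map (history S A V n)).prod (clocksLaw lam nu)) :
    P.map (fun ω => (history S A V n ω, (interTime S A V n ω, eventType S A V n ω))) =
      P.map (history S A V n) ⊗ₘ stepKernel lam nu n := by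
  have hS := hQ.measurable_init
  have hA := hQ.measurable_arrival
  have hV := hQ.measurable_service
  have hhe : Measurable fun ω =>
      (history S A V n ω, (interTime S A V n ω, eventType S A V n ω)) :=
    (measurable_history hS hA hV n).prodMk ((measurable_interTime hS hA hV n).prodMk
      (measurable_eventType hS hA hV n))
  have hw : Measurable fun ω => (simState S A V (n + 1) ω).2 :=
    measurable_snd.comp (measurable_simState hS hA hV (n + 1))
  have := congrArg Measure.fst (hQ.map_history_event_clocks hn)
  rwa [Measure.fst_map_prodMk hw,
    Measure.fst_prod] at this

/-- The residual clocks are independent of the observed history, and distributed as at time `0`. -/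
theorem IsMM1Queue.map_history_clocks (hQ : IsMM1Queue lam nu P S A V) (n : ℕ) :
    P.map (fun ω => (history S A V n ω, (simState S A V n ω).2)) =
      (P.map (history S A V n)).prod (clocksLaw lam nu) := by
  have hS := hQ.measurable_init
  have hA := hQ.measurable_arrival
  have hV := hQ.measurable_service
  induction n with
  | zero => exact hQ.map_history_zero
  | succ n ih =>
    have hhe : Measurable fun ω =>
        (history S A V n ω, (interTime S A V n ω, eventType S A V n ω)) :=
      (measurable_history hS hA hV n).prodMk ((measurable_interTime hS hA hV n).prodMk
        (measurable_eventType hS hA hV n))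
    have hw : Measurable fun ω => (simState S A V (n + 1) ω).2 :=
      measurable_snd.comp (measurable_simState hS hA hV (n + 1))
    have : IsProbabilityMeasure (P.map (history S A V n)) :=
      Measure.isProbabilityMeasure_map (measurable_history hS hA hV n).aemeasurable
    have h1 : history S A V (n + 1) = (fun p : History n × (ℝ × EventType) => historySnoc p.1 p.2) ∘
        fun ω => (history S A V n ω, (interTime S A V n ω, eventType S A V n ω)) :=
      funext fun ω => history_succ S A V n ω
    have h2 : (fun ω => (history S A V (n + 1) ω, (simState S A V (n + 1) ω).2)) =
        Prod.map (fun p : History n × (ℝ × EventType) => historySnoc p.1 p.2) id ∘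
        fun ω => ((history S A V n ω, (interTime S A V n ω, eventType S A V n ω)),
          (simState S A V (n + 1) ω).2) :=
      funext fun ω => Prod.ext (history_succ S A V n ω) rfl
    -- Appending the event to the history acts on the first factor only, so the product with
    -- `clocksLaw` survives.
    rw [h2, ← Measure.map_map ((measurable_snoc n).prodMap measurable_id) (hhe.prodMk hw),
      hQ.map_history_event_clocks ih, h1, ← Measure.map_map (measurable_snoc n) hhe,
      hQ.map_history_event_of_clocks ih, ← Measure.map_prod_map _ _ (measurable_snoc n)
        measurable_id, Measure.map_id]

/-- Given the history, the next inter-event time and event type follow the law `stepLaw`. -/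
theorem IsMM1Queue.map_history_event (hQ : IsMM1Queue lam nu P S A V) (n : ℕ) :
    P.map (fun ω => (history S A V n ω, (interTime S A V n ω, eventType S A V n ω))) =
      P.map (history S A V n) ⊗ₘ stepKernel lam nu n :=
  hQ.map_history_event_of_clocks (hQ.map_history_clocks n)

end

/-! ### The oracle's conditional laws -/

section

variable {lam nu : ℝ} [Fact (0 < lam)] [Fact (0 < nu)]
  {Ω : Type*} [MeasurableSpace Ω] {P : Measure Ω} [IsProbabilityMeasure P]
  {S : Ω → ℕ} {A V : ℕ → Ω → ℝ}

lemma IsMM1Queue.map_history_interTime (hQ : IsMM1Queue lam nu P S A V) (n : ℕ) :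
    P.map (fun ω => (history S A V n ω, interTime S A V n ω)) =
      P.map (history S A V n) ⊗ₘ (stepKernel lam nu n).fst := by
  have hS := hQ.measurable_init
  have hA := hQ.measurable_arrival
  have hV := hQ.measurable_service
  have hh := measurable_history hS hA hV n
  have hT := measurable_interTime hS hA hV n
  have hE := measurable_eventType hS hA hV n
  refine Measure.ext_of_lintegral _ fun f hf => ?_
  have hg : Measurable fun p : History n × (ℝ × EventType) => f (p.1, p.2.1) := by fun_prop
  rw [lintegral_map hf (hh.prodMk hT), Measure.lintegral_compProd hf,
    ← lintegral_map hg (hh.prodMk (hT.prodMk hE)), hQ.map_history_event,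
    Measure.lintegral_compProd hg]
  refine lintegral_congr fun h => ?_
  rw [Kernel.lintegral_fst _ _ (by fun_prop)]

/-- As `stepLaw` is a product, the elapsed time says nothing about the type; `prodMkRight` is the
kernel ignoring it. -/
lemma IsMM1Queue.map_history_interTime_eventType (hQ : IsMM1Queue lam nu P S A V) (n : ℕ) :
    P.map (fun ω => ((history S A V n ω, interTime S A V n ω), eventType S A V n ω)) =
      P.map (fun ω => (history S A V n ω, interTime S A V n ω)) ⊗ₘ
        (stepKernel lam nu n).snd.prodMkRight ℝ := by
  have hS := hQ.measurable_init
  have hA := hQ.measurable_arrival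
  have hV := hQ.measurable_service
  have hh := measurable_history hS hA hV n
  have hT := measurable_interTime hS hA hV n
  have hE := measurable_eventType hS hA hV n
  have : IsProbabilityMeasure (P.map fun ω => (history S A V n ω, interTime S A V n ω)) :=
    Measure.isProbabilityMeasure_map (hh.prodMk hT).aemeasurable
  refine Measure.ext_of_lintegral _ fun f hf => ?_
  have hg : Measurable fun p : History n × (ℝ × EventType) => f ((p.1, p.2.1), p.2.2) := by
    fun_prop
  rw [lintegral_map hf ((hh.prodMk hT).prodMk hE),
    ← lintegral_map hg (hh.prodMk (hT.prodMk hE)), hQ.map_history_event,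
    Measure.lintegral_compProd hg, Measure.lintegral_compProd hf, hQ.map_history_interTime,
    Measure.lintegral_compProd (Measurable.lintegral_kernel_prod_right' hf)]
  refine lintegral_congr fun h => ?_
  have h1 : (stepKernel lam nu n).fst h = expMeasure (eventRate lam nu (queueLength n h)) := by
    rw [Kernel.fst_apply, stepKernel_apply]
    exact Measure.fst_prod
  have h2 : ∀ t, (stepKernel lam nu n).snd.prodMkRight ℝ (h, t) =
      markLaw lam nu (queueLength n h) := fun t => by
    rw [Kernel.prodMkRight_apply, Kernel.snd_apply, stepKernel_apply]
    exact Measure.snd_prod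
  simp_rw [h1, h2, stepKernel_apply]
  exact lintegral_prod _ (hg.comp measurable_prodMk_left).aemeasurable

/-- A conditional distribution is unique up to a null set of histories, so any kernel disintegrating
the joint law agrees with it almost surely. -/
theorem IsMM1Queue.timeLaw_ae_eq (hQ : IsMM1Queue lam nu P S A V) (n : ℕ) :
    ∀ᵐ ω ∂P, timeLaw P S A V n ω = expMeasure (eventRate lam nu (simState S A V n ω).1) := by
  have hS := hQ.measurable_init
  have hA := hQ.measurable_arrival
  have hV := hQ.measurable_service
  have h := ae_of_ae_map (measurable_history hS hA hV n).aemeasurable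
    (condDistrib_ae_eq_of_measure_eq_compProd (history S A V n)
      (measurable_interTime hS hA hV n).aemeasurable (hQ.map_history_interTime n))
  filter_upwards [h] with ω hω
  rw [timeLaw, hω, Kernel.fst_apply, stepKernel_apply, queueLength_history]
  exact Measure.fst_prod

theorem IsMM1Queue.eventLaw_ae_eq (hQ : IsMM1Queue lam nu P S A V) (n : ℕ) :
    ∀ᵐ ω ∂P, eventLaw P S A V n ω = markLaw lam nu (simState S A V n ω).1 := by
  have hS := hQ.measurable_init
  have hA := hQ.measurable_arrival
  have hV := hQ.measurable_service
  have h := ae_of_ae_map ((measurable_history hS hA hV n).prodMk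
    (measurable_interTime hS hA hV n)).aemeasurable
    (condDistrib_ae_eq_of_measure_eq_compProd _
      (measurable_eventType hS hA hV n).aemeasurable (hQ.map_history_interTime_eventType n))
  filter_upwards [h] with ω hω
  rw [eventLaw, hω, Kernel.prodMkRight_apply, Kernel.snd_apply, stepKernel_apply,
    queueLength_history]
  exact Measure.snd_prod

end

/-! ### Laws of large numbers -/

section

/-- A strong law of large numbers for square integrable increments that are bounded below and
orthogonal to the preceding partial sums. -/
theorem ae_tendsto_sum_div_of_orthogonal {Ω : Type*} [MeasurableSpace Ω] {P : Measure Ω}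
    {X : ℕ → Ω → ℝ} {C c : ℝ} (hX : ∀ n, MemLp (X n) 2 P)
    (hsq : ∀ n, ∫ ω, X n ω ^ 2 ∂P ≤ C)
    (horth : ∀ n, ∫ ω, (∑ i ∈ Finset.range n, X i ω) * X n ω ∂P = 0)
    (hbelow : ∀ n ω, -c ≤ X n ω) :
    ∀ᵐ ω ∂P, Tendsto (fun N : ℕ => (∑ n ∈ Finset.range N, X n ω) / N) atTop (𝓝 0) := by
  have hC : 0 ≤ C := (integral_nonneg fun ω => sq_nonneg (X 0 ω)).trans (hsq 0)
  have hS : ∀ n, MemLp (fun ω => ∑ i ∈ Finset.range n, X i ω) 2 P := fun n =>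
    memLp_finsetSum _ fun i _ => hX i
  have hvar : ∀ n : ℕ, ∫ ω, (∑ i ∈ Finset.range n, X i ω) ^ 2 ∂P ≤ C * n := by
    intro n
    induction n with
    | zero => simp
    | succ n ih =>
      have h1 : ∀ ω, (∑ i ∈ Finset.range (n + 1), X i ω) ^ 2 =
          (∑ i ∈ Finset.range n, X i ω) ^ 2 + 2 * ((∑ i ∈ Finset.range n, X i ω) * X n ω) +
            X n ω ^ 2 := fun ω => by
        rw [Finset.sum_range_succ]
        ring
      have i1 := (hS n).integrable_sq
      have i2 : Integrable (fun ω => (∑ i ∈ Finset.range n, X i ω) * X n ω) P :=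
        (hS n).integrable_mul (hX n)
      have i3 := (hX n).integrable_sq
      simp_rw [h1]
      rw [integral_add (by exact i1.add (i2.const_mul 2)) i3, integral_add i1 (i2.const_mul 2),
        integral_const_mul, horth n]
      have := hsq n
      push_cast
      linarith
  -- Along the squares, the second moments of the averages are at most `C / (k + 1) ^ 2`, which is
  -- summable.
  set Y : ℕ → Ω → ℝ := fun k ω =>
    (∑ n ∈ Finset.range ((k + 1) ^ 2), X n ω) / ((k + 1) ^ 2 : ℕ) with hY
  have hYm : ∀ k, AEMeasurable (fun ω => ENNReal.ofReal (Y k ω ^ 2)) P := fun k =>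
    (((hS _).aestronglyMeasurable.aemeasurable.div_const _).pow_const 2).ennreal_ofReal
  have hYle : ∀ k, ∫⁻ ω, ENNReal.ofReal (Y k ω ^ 2) ∂P ≤
      ENNReal.ofReal (C * (1 / ((k : ℝ) + 1) ^ 2)) := fun k => by
    have hsqY : ∀ ω, Y k ω ^ 2 = (1 / ((k : ℝ) + 1) ^ 4) *
        (∑ n ∈ Finset.range ((k + 1) ^ 2), X n ω) ^ 2 := fun ω => by
      simp only [hY]
      push_cast
      field_simp
    rw [← ofReal_integral_eq_lintegral_ofReal]
    · refine ENNReal.ofReal_le_ofReal ?_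
      simp_rw [hsqY]
      rw [integral_const_mul]
      calc 1 / ((k : ℝ) + 1) ^ 4 * ∫ ω, (∑ n ∈ Finset.range ((k + 1) ^ 2), X n ω) ^ 2 ∂P
          ≤ 1 / ((k : ℝ) + 1) ^ 4 * (C * ((k + 1) ^ 2 : ℕ)) :=
            mul_le_mul_of_nonneg_left (hvar _) (by positivity)
        _ = C * (1 / ((k : ℝ) + 1) ^ 2) := by
            push_cast
            field_simp
    · simp_rw [hsqY]
      exact ((hS _).integrable_sq).const_mul _
    · exact ae_of_all _ fun ω => sq_nonneg _
  have hsum : ∑' k, ∫⁻ ω, ENNReal.ofReal (Y k ω ^ 2) ∂P ≠ ∞ := by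
    refine ne_top_of_le_ne_top ?_ (ENNReal.tsum_le_tsum hYle)
    have hs : Summable fun k : ℕ => C * (1 / ((k : ℝ) + 1) ^ 2) := by
      have := (summable_nat_add_iff 1).2 (Real.summable_one_div_nat_pow.2 one_lt_two)
      push_cast at this
      exact this.mul_left C
    rw [← ENNReal.ofReal_tsum_of_nonneg (fun k => by positivity) hs]
    exact ENNReal.ofReal_ne_top
  rw [← lintegral_tsum hYm] at hsum
  filter_upwards [ae_lt_top' (AEMeasurable.tsum hYm) hsum] with ω hω
  have hY0 : Tendsto (fun k => Y k ω) atTop (𝓝 0) := by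
    have h1 := ENNReal.tendsto_atTop_zero_of_tsum_ne_top hω.ne
    have h2 : Tendsto (fun k => Y k ω ^ 2) atTop (𝓝 0) := by
      have := (ENNReal.tendsto_toReal ENNReal.zero_ne_top).comp h1
      simpa [Function.comp_def, ENNReal.toReal_ofReal, sq_nonneg] using this
    have h3 := h2.sqrt
    simp only [Real.sqrt_sq_eq_abs, Real.sqrt_zero] at h3
    exact (tendsto_zero_iff_abs_tendsto_zero _).2 h3
  -- Adding `c` to each increment makes the partial sums monotone, which fills the gaps between
  -- squares.
  set u : ℕ → ℝ := fun N => ∑ n ∈ Finset.range N, X n ω + c * N with hu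
  have hmono : Monotone u := monotone_nat_of_le_succ fun n => by
    simp only [hu]
    rw [Finset.sum_range_succ]
    have := hbelow n ω
    push_cast
    linarith
  have hlim : Tendsto (fun N : ℕ => u N / N) atTop (𝓝 c) := by
    refine tendsto_div_of_monotone_of_exists_subseq_tendsto_div u c hmono fun a ha =>
      ⟨fun k => (k + 1) ^ 2, ?_, ?_, ?_⟩
    -- `(k + 2) ^ 2 ≤ a * (k + 1) ^ 2` means `2 * k + 3 ≤ (a - 1) * (k + 1) ^ 2`, which follows from
    -- `3 ≤ k * (a - 1)`.
    · filter_upwards [eventually_ge_atTop ⌈3 / (a - 1)⌉₊] with k hk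
      have h1 : 3 / (a - 1) ≤ k := Nat.ceil_le.1 hk
      have h2 : 3 ≤ k * (a - 1) := (div_le_iff₀ (sub_pos.2 ha)).1 h1
      push_cast
      nlinarith [(Nat.cast_nonneg k : (0 : ℝ) ≤ k)]
    · exact (tendsto_pow_atTop two_ne_zero).comp (tendsto_add_atTop_nat 1)
    · have : (fun k : ℕ => u ((k + 1) ^ 2) / (((k + 1) ^ 2 : ℕ) : ℝ)) = fun k => Y k ω + c := by
        funext k
        have : (((k + 1) ^ 2 : ℕ) : ℝ) ≠ 0 := by positivity
        simp only [hu, hY]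
        field_simp
      rw [this]
      simpa using hY0.add_const c
  have hfin := hlim.sub_const c
  rw [sub_self] at hfin
  refine hfin.congr' ?_
  filter_upwards [eventually_gt_atTop 0] with N hN
  have : (N : ℝ) ≠ 0 := by positivity
  simp only [hu]
  field_simp
  ring

variable {lam nu : ℝ} [Fact (0 < lam)] [Fact (0 < nu)]
  {Ω : Type*} [MeasurableSpace Ω] {P : Measure Ω} [IsProbabilityMeasure P]
  {S : Ω → ℕ} {A V : ℕ → Ω → ℝ}

/-- The sum of a function of the queue length and of the next event along a history. -/
def historySum (f : ℕ → ℝ × EventType → ℝ) : (n : ℕ) → History n → ℝ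
  | 0, _ => 0
  | n + 1, h => historySum f n (historyInit h) +
      f (queueLength n (historyInit h)) (h.2 (Fin.last n))

lemma measurable_historySum {f : ℕ → ℝ × EventType → ℝ} (hf : ∀ q, Measurable (f q)) (n : ℕ) :
    Measurable (historySum f n) := by
  induction n with
  | zero => exact measurable_const
  | succ n ih =>
    have hf' : Measurable (Function.uncurry f) := measurable_from_prod_countable_right hf
    exact (ih.comp (measurable_init n)).add (hf'.comp (((measurable_queueLength n).comp
      (measurable_init n)).prodMk ((measurable_pi_apply (Fin.last n)).comp measurable_snd)))

lemma historySum_history {Ω : Type*} (S : Ω → ℕ) (A V : ℕ → Ω → ℝ) (f : ℕ → ℝ × EventType → ℝ)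
    (n : ℕ) (ω : Ω) : historySum f n (history S A V n ω) =
      ∑ i ∈ Finset.range n,
        f (simState S A V i ω).1 (interTime S A V i ω, eventType S A V i ω) := by
  induction n with
  | zero => rfl
  | succ n ih =>
    rw [historySum, init_history, ih, Finset.sum_range_succ, queueLength_history]
    rfl

/-- The law of large numbers for functions of the queue length and of the next event that are
centred under the conditional law given the queue length. -/
theorem IsMM1Queue.ae_tendsto_average (hQ : IsMM1Queue lam nu P S A V)
    {f : ℕ → ℝ × EventType → ℝ} (hf : ∀ q, Measurable (f q)) {C c : ℝ}
    (hint : ∀ q, Integrable (fun z => f q z ^ 2) (stepLaw lam nu q))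
    (hsq : ∀ q, ∫ z, f q z ^ 2 ∂stepLaw lam nu q ≤ C)
    (hmean : ∀ q, ∫ z, f q z ∂stepLaw lam nu q = 0) (hbelow : ∀ q z, -c ≤ f q z) :
    ∀ᵐ ω ∂P, Tendsto (fun N : ℕ => (∑ n ∈ Finset.range N,
      f (simState S A V n ω).1 (interTime S A V n ω, eventType S A V n ω)) / N) atTop (𝓝 0) := by
  have hS := hQ.measurable_init
  have hA := hQ.measurable_arrival
  have hV := hQ.measurable_service
  have hh := measurable_history hS hA hV
  have hhe : ∀ n, Measurable fun ω =>
      (history S A V n ω, (interTime S A V n ω, eventType S A V n ω)) := fun n =>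
    (hh n).prodMk ((measurable_interTime hS hA hV n).prodMk (measurable_eventType hS hA hV n))
  have hμ : ∀ n, IsProbabilityMeasure (P.map (history S A V n)) := fun n =>
    Measure.isProbabilityMeasure_map (hh n).aemeasurable
  have hf' : Measurable (Function.uncurry f) := measurable_from_prod_countable_right hf
  set F : (n : ℕ) → History n × (ℝ × EventType) → ℝ := fun n p => f (queueLength n p.1) p.2 with hF
  have hFm : ∀ n, Measurable (F n) := fun n =>
    hf'.comp (((measurable_queueLength n).comp measurable_fst).prodMk measurable_snd)
  have hX : ∀ n ω, f (simState S A V n ω).1 (interTime S A V n ω, eventType S A V n ω) =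
      F n (history S A V n ω, (interTime S A V n ω, eventType S A V n ω)) := fun n ω => by
    simp only [hF, queueLength_history]
  have hFint : ∀ n, Integrable (fun p => F n p ^ 2)
      (P.map (history S A V n) ⊗ₘ stepKernel lam nu n) := fun n => by
    rw [Measure.integrable_compProd_iff ((hFm n).pow_const 2).aestronglyMeasurable]
    refine ⟨ae_of_all _ fun h => hint _, ?_⟩
    refine Integrable.of_bound (C := C) ?_ (ae_of_all _ fun h => ?_)
    · exact ((hFm n).pow_const 2).norm.stronglyMeasurable.integral_kernel_prod_right'
        |>.aestronglyMeasurable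
    · rw [Real.norm_of_nonneg (integral_nonneg fun z => norm_nonneg _)]
      simp only [Real.norm_eq_abs, abs_pow, sq_abs]
      exact hsq _
  have hX2 : ∀ n, MemLp (fun ω => f (simState S A V n ω).1
      (interTime S A V n ω, eventType S A V n ω)) 2 P := fun n => by
    simp_rw [hX n]
    refine (memLp_two_iff_integrable_sq ((hFm n).comp (hhe n)).aestronglyMeasurable).2 ?_
    have := hFint n
    rw [← hQ.map_history_event n] at this
    exact this.comp_measurable (hhe n)
  refine ae_tendsto_sum_div_of_orthogonal hX2 (C := C) (c := c) (fun n => ?_) (fun n => ?_)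
    fun n ω => hbelow _ _
  · simp_rw [hX n]
    rw [← integral_map (f := fun p => F n p ^ 2) (hhe n).aemeasurable
      ((hFm n).pow_const 2).aestronglyMeasurable, hQ.map_history_event n,
      Measure.integral_compProd (hFint n)]
    calc ∫ h, ∫ z, F n (h, z) ^ 2 ∂stepKernel lam nu n h ∂P.map (history S A V n)
        ≤ ∫ _, C ∂P.map (history S A V n) := by
          refine integral_mono ?_ (integrable_const C) fun h => hsq _
          have := (Measure.integrable_compProd_iff
            ((hFm n).pow_const 2).aestronglyMeasurable).1 (hFint n)
          simpa using this.2
      _ = C := by simp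
  -- Orthogonality: the past sum is a function of the history, so it leaves the inner integral,
  -- which is zero by `hmean`.
  · have hprod := (memLp_finsetSum (Finset.range n) fun i _ => hX2 i).integrable_mul (hX2 n)
    have hgm : Measurable fun p : History n × (ℝ × EventType) => historySum f n p.1 * F n p :=
      ((measurable_historySum hf n).comp measurable_fst).mul (hFm n)
    have heq : ∀ ω, (∑ i ∈ Finset.range n, f (simState S A V i ω).1
        (interTime S A V i ω, eventType S A V i ω)) *
          f (simState S A V n ω).1 (interTime S A V n ω, eventType S A V n ω) =
        (fun p : History n × (ℝ × EventType) => historySum f n p.1 * F n p)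
          (history S A V n ω, (interTime S A V n ω, eventType S A V n ω)) := fun ω => by
      simp only [historySum_history, hX]
    have hi : Integrable (fun p : History n × (ℝ × EventType) => historySum f n p.1 * F n p)
        (P.map (history S A V n) ⊗ₘ stepKernel lam nu n) := by
      rw [← hQ.map_history_event n,
        integrable_map_measure hgm.aestronglyMeasurable (hhe n).aemeasurable]
      exact hprod.congr (ae_of_all _ heq)
    simp_rw [heq]
    rw [← integral_map (hhe n).aemeasurable hgm.aestronglyMeasurable, hQ.map_history_event n,
      Measure.integral_compProd hi]
    simp_rw [integral_const_mul]
    have h0 : ∀ h, ∫ z, F n (h, z) ∂stepKernel lam nu n h = 0 := fun h => hmean _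
    simp [h0]

end

/-! ### Moments of the exponential law -/

lemma integral_expMeasure {r : ℝ} (hr : 0 < r) (f : ℝ → ℝ) :
    ∫ x, f x ∂expMeasure r = ∫ x in Set.Ioi 0, r * Real.exp (-(r * x)) * f x := by
  have h : expMeasure r = volume.withDensity (exponentialPDF r) := rfl
  rw [h, integral_withDensity_eq_integral_toReal_smul (measurable_exponentialPDF r)
    (ae_of_all _ fun x => ENNReal.ofReal_lt_top), ← integral_Ici_eq_integral_Ioi,
    ← integral_indicator measurableSet_Ici]
  refine integral_congr_ae (ae_of_all _ fun x => ?_)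
  by_cases hx : 0 ≤ x
  · simp only [exponentialPDF_of_nonneg hx, smul_eq_mul, Set.indicator, Set.mem_Ici, hx, if_true]
    rw [ENNReal.toReal_ofReal (by positivity)]
  · simp [exponentialPDF_of_neg (not_le.1 hx), Set.indicator, hx]

lemma integral_pow_expMeasure {r : ℝ} (hr : 0 < r) (k : ℕ) :
    ∫ x, x ^ k ∂expMeasure r = (k.factorial : ℝ) / r ^ k := by
  have h := Real.integral_rpow_mul_exp_neg_mul_Ioi (a := k + 1) (by positivity) hr
  rw [integral_expMeasure hr]
  have h1 : ∀ x : ℝ, r * Real.exp (-(r * x)) * x ^ k =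
      r * (x ^ ((k : ℝ) + 1 - 1) * Real.exp (-(r * x))) := fun x => by
    rw [add_sub_cancel_right, Real.rpow_natCast]
    ring
  simp_rw [h1]
  rw [integral_const_mul, h, Real.Gamma_nat_eq_factorial]
  have : ((1 : ℝ) / r) ^ ((k : ℝ) + 1) = 1 / r ^ (k + 1) := by
    rw [← Nat.cast_succ, Real.rpow_natCast, one_div_pow]
  rw [this]
  field_simp
  ring

lemma integrable_pow_expMeasure {r : ℝ} (hr : 0 < r) (k : ℕ) :
    Integrable (fun x => x ^ k) (expMeasure r) := by
  -- A non-integrable function has integral 0 by convention, so a nonzero moment proves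
  -- integrability.
  refine Integrable.of_integral_ne_zero ?_
  rw [integral_pow_expMeasure hr]
  positivity

lemma integrable_eval_expMeasure {r : ℝ} (hr : 0 < r) (p : Polynomial ℝ) :
    Integrable (fun x => p.eval x) (expMeasure r) := by
  simp_rw [Polynomial.eval_eq_sum, Polynomial.sum]
  exact integrable_finsetSum _ fun i _ => (integrable_pow_expMeasure hr i).const_mul _

/-- The mean is `1 / r` and the variance `1 / r ^ 2`. -/
lemma integral_sq_inv_sub_expMeasure {r : ℝ} (hr : 0 < r) :
    ∫ x, ((1 / r - x) ^ 2 - 1 / r ^ 2) ∂expMeasure r = 0 := by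
  have h1 : ∀ x : ℝ, (1 / r - x) ^ 2 - 1 / r ^ 2 = x ^ 2 - 2 / r * x ^ 1 := fun x => by
    field_simp
    ring
  simp_rw [h1]
  rw [integral_sub (integrable_pow_expMeasure hr 2) ((integrable_pow_expMeasure hr 1).const_mul _),
    integral_const_mul, integral_pow_expMeasure hr, integral_pow_expMeasure hr]
  simp
  field_simp
  norm_num

lemma integrable_sq_sq_inv_sub_expMeasure {r : ℝ} (hr : 0 < r) :
    Integrable (fun x => ((1 / r - x) ^ 2 - 1 / r ^ 2) ^ 2) (expMeasure r) := by
  have := integrable_eval_expMeasure hr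
    (((Polynomial.C (1 / r) - Polynomial.X) ^ 2 - Polynomial.C (1 / r ^ 2)) ^ 2)
  simpa using this

/-- The mean determines the rate. This pins down the witness chosen in `exponentialRate`. -/
lemma expMeasure_injective {r s : ℝ} (hr : 0 < r) (hs : 0 < s) (h : expMeasure r = expMeasure s) :
    r = s := by
  have h1 := integral_pow_expMeasure hr 1
  rw [h, integral_pow_expMeasure hs 1] at h1
  simp at h1
  exact h1.symm

lemma exponentialRate_expMeasure {r : ℝ} (hr : 0 < r) : exponentialRate (expMeasure r) = r := by
  have h : ∃ s : ℝ, 0 < s ∧ expMeasure r = expMeasure s := ⟨r, hr, rfl⟩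
  rw [exponentialRate, dif_pos h]
  exact (expMeasure_injective hr h.choose_spec.1 h.choose_spec.2).symm

/-! ### Deterministic analysis of queue length sequences -/

/-- The increment `±1` of an event. -/
def eventSign : EventType → ℝ
  | .arrival => 1
  | .departure => -1

/-- The centred increment of the queue length when the server is busy, with drift `c`. -/
def centredSign (c : ℝ) (q : ℕ) (e : EventType) : ℝ := if q = 0 then 0 else eventSign e - c

lemma centredSign_zero (c : ℝ) (e : EventType) : centredSign c 0 e = 0 := if_pos rfl

lemma centredSign_of_ne {k : ℕ} (hk : k ≠ 0) (c : ℝ) (e : EventType) :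
    centredSign c k e = eventSign e - c := if_neg hk

section Deterministic

variable {q : ℕ → ℕ} {e : ℕ → EventType} {c : ℝ}

/-- The number of events before event `N` that start with an idle server. -/
def idleCount (q : ℕ → ℕ) (N : ℕ) : ℝ := ∑ n ∈ Finset.range N, if q n = 0 then 1 else 0

lemma cast_nextLength {k : ℕ} (hk : k ≠ 0) (ε : EventType) :
    (nextLength k ε : ℝ) = k + eventSign ε := by
  cases ε
  · simp [nextLength, eventSign]
  · obtain ⟨m, rfl⟩ := Nat.exists_eq_succ_of_ne_zero hk
    simp [nextLength, eventSign]

/-- The running maximum of `|M|` is still `o(N)`: late terms are at most `ε / 2 * n`, and the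
finitely many early ones are absorbed once `N ≥ 2 * B / ε`. -/
lemma tendsto_prefixBound_div {M : ℕ → ℝ} (hM : Tendsto (fun N : ℕ => M N / N) atTop (𝓝 0)) :
    ∃ m : ℕ → ℝ, Monotone m ∧ (∀ N, |M N| ≤ m N) ∧
      Tendsto (fun N : ℕ => m N / N) atTop (𝓝 0) := by
  refine ⟨fun N => (Finset.range (N + 1)).sup' ⟨0, by simp⟩ fun n => |M n|, ?_, ?_, ?_⟩
  · intro a b hab
    exact Finset.sup'_mono _ (Finset.range_mono (by omega)) _
  · intro N
    exact Finset.le_sup' (fun n => |M n|) (by simp)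
  · rw [Metric.tendsto_atTop] at hM ⊢
    intro ε hε
    obtain ⟨K, hK⟩ := hM (ε / 2) (by positivity)
    set B := (Finset.range (K + 1)).sup' ⟨0, by simp⟩ fun n => |M n| with hB
    have hB0 : 0 ≤ B := (abs_nonneg (M 0)).trans (Finset.le_sup' (fun n => |M n|) (by simp))
    refine ⟨⌈2 * B / ε⌉₊ + K + 1, fun N hN => ?_⟩
    have hN0 : (0 : ℝ) < N := by
      have : 0 < N := by omega
      exact_mod_cast this
    have hBN : B ≤ ε / 2 * N := by
      have h1 : 2 * B / ε ≤ N := (Nat.le_ceil _).trans (by exact_mod_cast (by omega))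
      rw [div_le_iff₀ hε] at h1
      linarith
    have hsup : (Finset.range (N + 1)).sup' ⟨0, by simp⟩ (fun n => |M n|) ≤ ε / 2 * N := by
      refine Finset.sup'_le _ _ fun n hn => ?_
      by_cases hnK : n < K + 1
      · exact (Finset.le_sup' (fun n => |M n|) (Finset.mem_range.2 hnK)).trans hBN
      · have hn0 : (0 : ℝ) < n := by
          have : 0 < n := by omega
          exact_mod_cast this
        have h2 := hK n (by omega)
        rw [Real.dist_eq, sub_zero, abs_div, abs_of_pos hn0, div_lt_iff₀ hn0] at h2
        have h3 : (n : ℝ) ≤ N := by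
          have := Finset.mem_range.1 hn
          exact_mod_cast (by omega : n ≤ N)
        nlinarith
    have hnn : 0 ≤ (Finset.range (N + 1)).sup' ⟨0, by simp⟩ (fun n => |M n|) :=
      (abs_nonneg (M 0)).trans (Finset.le_sup' (fun n => |M n|) (by simp))
    rw [Real.dist_eq, sub_zero, abs_of_nonneg (by positivity), div_lt_iff₀ hN0]
    nlinarith

/-- An idle event adds exactly 1; a busy one adds `c` plus its centred sign. -/
lemma queue_balance (hidle : ∀ n, q n = 0 → e n = EventType.arrival)
    (hnext : ∀ n, q (n + 1) = nextLength (q n) (e n))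
    (N : ℕ) : (q N : ℝ) = q 0 + idleCount q N + c * (N - idleCount q N) +
    ∑ n ∈ Finset.range N, centredSign c (q n) (e n) := by
  induction N with
  | zero => simp [idleCount]
  | succ N ih =>
    rw [hnext, idleCount, Finset.sum_range_succ, Finset.sum_range_succ, ← idleCount]
    by_cases h : q N = 0
    · rw [h] at ih ⊢
      rw [hidle N h, centredSign_zero]
      simp only [nextLength, if_true]
      push_cast at ih ⊢
      linarith
    · rw [cast_nextLength h, ih, centredSign_of_ne h, if_neg h]
      push_cast
      ring

/-- Reflection: a busy event changes queue minus walk by `c ≤ 0`, and an idle one resets the queue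
to 1, when the difference is at most `1 + m N`. -/
lemma queue_le_of_drift_nonpos (hidle : ∀ n, q n = 0 → e n = EventType.arrival)
    (hnext : ∀ n, q (n + 1) = nextLength (q n) (e n))
    (hc : c ≤ 0) {m : ℕ → ℝ} (hm : Monotone m)
    (hle : ∀ N, |∑ n ∈ Finset.range N, centredSign c (q n) (e n)| ≤ m N) (N : ℕ) :
    (q N : ℝ) - ∑ n ∈ Finset.range N, centredSign c (q n) (e n) ≤ q 0 + 1 + m N := by
  have hm0 : ∀ k, 0 ≤ m k := fun k => (abs_nonneg _).trans (hle k)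
  induction N with
  | zero =>
    simp only [Finset.range_zero, Finset.sum_empty, sub_zero]
    linarith [hm0 0]
  | succ N ih =>
    have hmN := hm (Nat.le_succ N)
    rw [hnext, Finset.sum_range_succ]
    by_cases h : q N = 0
    · rw [h, hidle N h, centredSign_zero]
      simp only [nextLength]
      have := neg_le_of_abs_le (hle N)
      have := (Nat.cast_nonneg (q 0) : (0 : ℝ) ≤ q 0)
      push_cast
      linarith
    · rw [cast_nextLength h, centredSign_of_ne h]
      linarith

lemma idleCount_le_of_drift_nonneg (hidle : ∀ n, q n = 0 → e n = EventType.arrival)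
    (hnext : ∀ n, q (n + 1) = nextLength (q n) (e n))
    (hc : 0 ≤ c) {m : ℕ → ℝ} (hm : Monotone m)
    (hle : ∀ N, |∑ n ∈ Finset.range N, centredSign c (q n) (e n)| ≤ m N) (N : ℕ) :
    idleCount q N ≤ 1 + m N := by
  have hm0 : ∀ k, 0 ≤ m k := fun k => (abs_nonneg _).trans (hle k)
  induction N with
  | zero =>
    simp only [idleCount, Finset.range_zero, Finset.sum_empty]
    linarith [hm0 0]
  | succ N ih =>
    have hmN := hm (Nat.le_succ N)
    rw [idleCount, Finset.sum_range_succ, ← idleCount]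
    by_cases h : q N = 0
    -- The count grows only when the queue is empty. There the balance reads `0 = q 0 + Z + c * (N -
    -- Z) + M`, so `Z ≤ -M ≤ m N`, and this event adds 1.
    · have hb := queue_balance (c := c) hidle hnext N
      have hZ : idleCount q N ≤ N := by
        calc idleCount q N ≤ ∑ n ∈ Finset.range N, (1 : ℝ) :=
              Finset.sum_le_sum fun n _ => by split_ifs <;> norm_num
          _ = N := by simp
      have h0 := (Nat.cast_nonneg (q 0) : (0 : ℝ) ≤ q 0)
      have := neg_le_of_abs_le (hle N)
      have := mul_nonneg hc (sub_nonneg.2 hZ)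
      rw [h] at hb ⊢
      simp only [if_true]
      push_cast at hb
      linarith
    · simp only [h, if_false]
      linarith

/-- The long-run fraction of events that start with an idle server. -/
theorem tendsto_idleCount_div_of_drift_nonpos (hidle : ∀ n, q n = 0 → e n = EventType.arrival)
    (hnext : ∀ n, q (n + 1) = nextLength (q n) (e n))
    (hc : c ≤ 0)
    (hM : Tendsto (fun N : ℕ => (∑ n ∈ Finset.range N, centredSign c (q n) (e n)) / N) atTop
      (𝓝 0)) :
    Tendsto (fun N : ℕ => idleCount q N / N) atTop (𝓝 (-c / (1 - c))) := by
  obtain ⟨m, hm, hle, hlim⟩ := tendsto_prefixBound_div hM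
  have hconst : Tendsto (fun N : ℕ => ((q 0 : ℝ) + 1) / N) atTop (𝓝 0) :=
    tendsto_const_div_atTop_nhds_zero_nat _
  have hq : Tendsto (fun N : ℕ => (q N : ℝ) / N) atTop (𝓝 0) := by
    have hup := (hconst.add hlim).add hM
    rw [add_zero, add_zero] at hup
    refine squeeze_zero (fun N => by positivity) (fun N => ?_) hup
    rw [← add_div, ← add_div]
    refine div_le_div_of_nonneg_right ?_ (Nat.cast_nonneg N)
    have := queue_le_of_drift_nonpos hidle hnext hc hm hle N
    linarith
  have hq0 : Tendsto (fun N : ℕ => (q 0 : ℝ) / N) atTop (𝓝 0) :=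
    tendsto_const_div_atTop_nhds_zero_nat _
  have hc1 : 1 - c ≠ 0 := by linarith
  -- `queue_balance` divided by `N` and solved for the idle fraction, all other terms having limits.
  have hfin := (((hq.sub hq0).sub hM).sub_const c).div_const (1 - c)
  simp only [sub_zero, zero_sub] at hfin
  refine hfin.congr' ?_
  filter_upwards [eventually_gt_atTop 0] with N hN
  have hN' : (N : ℝ) ≠ 0 := by positivity
  have := queue_balance (c := c) hidle hnext N
  field_simp
  linarith

theorem tendsto_idleCount_div_of_drift_nonneg (hidle : ∀ n, q n = 0 → e n = EventType.arrival)
    (hnext : ∀ n, q (n + 1) = nextLength (q n) (e n))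
    (hc : 0 ≤ c)
    (hM : Tendsto (fun N : ℕ => (∑ n ∈ Finset.range N, centredSign c (q n) (e n)) / N) atTop
      (𝓝 0)) :
    Tendsto (fun N : ℕ => idleCount q N / N) atTop (𝓝 0) := by
  obtain ⟨m, hm, hle, hlim⟩ := tendsto_prefixBound_div hM
  have hconst : Tendsto (fun N : ℕ => (1 : ℝ) / N) atTop (𝓝 0) :=
    tendsto_const_div_atTop_nhds_zero_nat _
  have hup := hconst.add hlim
  rw [add_zero] at hup
  refine squeeze_zero (fun N => ?_) (fun N => ?_) hup
  · exact div_nonneg (Finset.sum_nonneg fun n _ => by split_ifs <;> norm_num) (Nat.cast_nonneg N)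
  · rw [← add_div]
    exact div_le_div_of_nonneg_right (idleCount_le_of_drift_nonneg hidle hnext hc hm hle N)
      (Nat.cast_nonneg N)

end Deterministic

/-! ### Limits of the average losses -/

section

section Moments

variable (lam nu : ℝ) [Fact (0 < lam)] [Fact (0 < nu)]

lemma integral_stepLaw_fst (q : ℕ) {f : ℝ → ℝ} (hf : Measurable f) :
    ∫ z, f z.1 ∂stepLaw lam nu q = ∫ t, f t ∂expMeasure (eventRate lam nu q) := by
  have h : (stepLaw lam nu q).map Prod.fst = expMeasure (eventRate lam nu q) := Measure.fst_prod
  rw [← h, integral_map measurable_fst.aemeasurable hf.aestronglyMeasurable]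

lemma integrable_stepLaw_fst (q : ℕ) {f : ℝ → ℝ}
    (hi : Integrable f (expMeasure (eventRate lam nu q))) :
    Integrable (fun z : ℝ × EventType => f z.1) (stepLaw lam nu q) := by
  have h : (stepLaw lam nu q).map Prod.fst = expMeasure (eventRate lam nu q) := Measure.fst_prod
  rw [← h] at hi
  exact hi.comp_measurable measurable_fst

lemma integral_stepLaw_snd_succ (q : ℕ) (f : EventType → ℝ) :
    ∫ z, f z.2 ∂stepLaw lam nu (q + 1) =
      lam / (lam + nu) * f .arrival + nu / (lam + nu) * f .departure := by
  have ha : 0 < lam := Fact.out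
  have hb : 0 < nu := Fact.out
  have h : (stepLaw lam nu (q + 1)).map Prod.snd = markLaw lam nu (q + 1) := Measure.snd_prod
  rw [← integral_map (f := f) measurable_snd.aemeasurable
    Measurable.of_discrete.aestronglyMeasurable, h, markLaw, if_neg (Nat.succ_ne_zero q),
    integral_add_measure]
  · rw [integral_smul_measure, integral_smul_measure, integral_dirac, integral_dirac,
      ENNReal.toReal_ofReal (by positivity), ENNReal.toReal_ofReal (by positivity)]
    rfl
  · exact (integrable_dirac (by simp)).smul_measure ENNReal.ofReal_ne_top
  · exact (integrable_dirac (by simp)).smul_measure ENNReal.ofReal_ne_top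

end Moments

/-- A function of a two-valued type is affine in its sign, so averaging the log-likelihood reduces
to averaging `centredSign`. -/
lemma log_measureReal_markLaw_of_ne {lam nu : ℝ} (ha : 0 < lam) (hb : 0 < nu) {q : ℕ} (hq : q ≠ 0)
    (e : EventType) : Real.log ((markLaw lam nu q).real {e}) =
      (Real.log (lam / (lam + nu)) + Real.log (nu / (lam + nu))) / 2 +
        (Real.log (lam / (lam + nu)) - Real.log (nu / (lam + nu))) / 2 * eventSign e := by
  have h1 : 0 ≤ lam / (lam + nu) := by positivity
  have h2 : 0 ≤ nu / (lam + nu) := by positivity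
  rw [markLaw, if_neg hq, Measure.real]
  cases e
  · simp only [Measure.coe_add, Measure.coe_smul, Pi.add_apply, Pi.smul_apply, smul_eq_mul,
      Measure.dirac_apply, eventSign]
    simp [h1]
    ring
  · simp only [Measure.coe_add, Measure.coe_smul, Pi.add_apply, Pi.smul_apply, smul_eq_mul,
      Measure.dirac_apply, eventSign]
    simp [h2]
    ring

variable {lam nu : ℝ} [Fact (0 < lam)] [Fact (0 < nu)]
  {Ω : Type*} [MeasurableSpace Ω] {P : Measure Ω} [IsProbabilityMeasure P]
  {S : Ω → ℕ} {A V : ℕ → Ω → ℝ}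

lemma IsMM1Queue.ae_tendsto_centredSign (hQ : IsMM1Queue lam nu P S A V) :
    ∀ᵐ ω ∂P, Tendsto (fun N : ℕ => (∑ n ∈ Finset.range N, centredSign ((lam - nu) / (lam + nu))
      (simState S A V n ω).1 (eventType S A V n ω)) / N) atTop (𝓝 0) := by
  have ha : 0 < lam := Fact.out
  have hb : 0 < nu := Fact.out
  set c := (lam - nu) / (lam + nu) with hc
  have hbound : ∀ q e, |centredSign c q e| ≤ 1 + |c| := fun q e => by
    unfold centredSign
    split_ifs
    · rw [abs_zero]
      positivity
    · refine (abs_sub _ _).trans (add_le_add_left ?_ _)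
      cases e <;> simp [eventSign]
  have hm : ∀ q, Measurable fun z : ℝ × EventType => centredSign c q z.2 := fun q =>
    (Measurable.of_discrete (f := centredSign c q)).comp measurable_snd
  have hsqb : ∀ q (z : ℝ × EventType), centredSign c q z.2 ^ 2 ≤ (1 + |c|) ^ 2 := fun q z =>
    sq_le_sq' (neg_le_of_abs_le (hbound q z.2)) (le_of_abs_le (hbound q z.2))
  have hi : ∀ q, Integrable (fun z : ℝ × EventType => centredSign c q z.2 ^ 2)
      (stepLaw lam nu q) := fun q =>
    Integrable.of_bound ((hm q).pow_const 2).aestronglyMeasurable ((1 + |c|) ^ 2)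
      (ae_of_all _ fun z => by
        rw [Real.norm_of_nonneg (sq_nonneg _)]
        exact hsqb q z)
  refine hQ.ae_tendsto_average (f := fun q z => centredSign c q z.2) (C := (1 + |c|) ^ 2)
    (c := 1 + |c|) hm hi (fun q => ?_) (fun q => ?_) fun q z => neg_le_of_abs_le (hbound q z.2)
  · calc ∫ z, centredSign c q z.2 ^ 2 ∂stepLaw lam nu q
        ≤ ∫ _, (1 + |c|) ^ 2 ∂stepLaw lam nu q :=
          integral_mono (hi q) (integrable_const _) (hsqb q)
      _ = (1 + |c|) ^ 2 := by simp
  · cases q with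
    | zero => simp [centredSign_zero]
    | succ q =>
      rw [integral_stepLaw_snd_succ]
      -- The drift is the arrival probability minus the departure probability, so the centred sign
      -- has mean zero.
      simp only [centredSign_of_ne (Nat.succ_ne_zero q), eventSign, hc]
      field_simp
      ring

lemma IsMM1Queue.ae_tendsto_centredTime (hQ : IsMM1Queue lam nu P S A V) :
    ∀ᵐ ω ∂P, Tendsto (fun N : ℕ => (∑ n ∈ Finset.range N,
      ((1 / eventRate lam nu (simState S A V n ω).1 - interTime S A V n ω) ^ 2 -
        1 / eventRate lam nu (simState S A V n ω).1 ^ 2)) / (N : ℝ)) atTop (𝓝 0) := by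
  have ha : 0 < lam := Fact.out
  have hb : 0 < nu := Fact.out
  have hr : ∀ q, 0 < eventRate lam nu q := fun q => Fact.out
  set g : ℕ → ℝ → ℝ := fun q t =>
    (1 / eventRate lam nu q - t) ^ 2 - 1 / eventRate lam nu q ^ 2 with hg
  have hm : ∀ q, Measurable (g q) := fun q => by fun_prop
  set K : ℕ → ℝ := fun q => ∫ t, g q t ^ 2 ∂expMeasure (eventRate lam nu q) with hK
  have hK0 : ∀ q, 0 ≤ K q := fun q => integral_nonneg fun t => sq_nonneg _
  -- The rate takes only two values, so `K 0 + K 1` bounds every second moment. The lower bound uses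
  -- that rates are at least `lam`.
  refine hQ.ae_tendsto_average (f := fun q z => g q z.1) (C := K 0 + K 1)
    (c := 1 / lam ^ 2) (fun q => (hm q).comp measurable_fst) (fun q => ?_) (fun q => ?_)
    (fun q => ?_) fun q z => ?_
  · exact integrable_stepLaw_fst lam nu q (f := fun t => g q t ^ 2)
      (integrable_sq_sq_inv_sub_expMeasure (hr q))
  · rw [integral_stepLaw_fst lam nu q (f := fun t => g q t ^ 2) ((hm q).pow_const 2)]
    cases q with
    | zero => exact le_add_of_nonneg_right (hK0 1)
    | succ q =>
      have : eventRate lam nu (q + 1) = eventRate lam nu 1 := by simp [eventRate]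
      have h1 : g (q + 1) = g 1 := by simp only [hg, this]
      rw [this, h1]
      exact le_add_of_nonneg_left (hK0 0)
  · rw [integral_stepLaw_fst lam nu q (hm q)]
    exact integral_sq_inv_sub_expMeasure (hr q)
  · have h1 : lam ≤ eventRate lam nu q := by
      unfold eventRate
      split_ifs <;> linarith
    have h2 : 1 / eventRate lam nu q ^ 2 ≤ 1 / lam ^ 2 := by gcongr
    have h3 := sq_nonneg (1 / eventRate lam nu q - z.1)
    simp only [hg]
    linarith

/-- The average losses of the oracle converge once the fraction of events that start with an idle
server does. -/
theorem IsMM1Queue.ae_tendsto_losses (hQ : IsMM1Queue lam nu P S A V) {π : ℝ}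
    (hπ : ∀ (q : ℕ → ℕ) (e : ℕ → EventType), (∀ n, q n = 0 → e n = EventType.arrival) →
      (∀ n, q (n + 1) = nextLength (q n) (e n)) →
      Tendsto (fun N : ℕ => (∑ n ∈ Finset.range N,
        centredSign ((lam - nu) / (lam + nu)) (q n) (e n)) / N) atTop (𝓝 0) →
      Tendsto (fun N : ℕ => idleCount q N / N) atTop (𝓝 π)) :
    ∀ᵐ ω ∂P,
      Tendsto (fun N : ℕ => avgEventLoss P S A V N ω) atTop
        (𝓝 (-((1 - π) * (lam / (lam + nu) * Real.log (lam / (lam + nu)) +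
          nu / (lam + nu) * Real.log (nu / (lam + nu)))))) ∧
      Tendsto (fun N : ℕ => avgTimeLoss P S A V N ω) atTop
        (𝓝 (π / lam ^ 2 + (1 - π) / (lam + nu) ^ 2)) := by
  have ha : 0 < lam := Fact.out
  have hb : 0 < nu := Fact.out
  have hr : ∀ q, 0 < eventRate lam nu q := fun q => Fact.out
  filter_upwards [ae_all_iff.2 hQ.timeLaw_ae_eq, ae_all_iff.2 hQ.eventLaw_ae_eq,
    hQ.ae_tendsto_centredSign, hQ.ae_tendsto_centredTime] with ω htime hevent hsign hsq
  set q : ℕ → ℕ := fun n => (simState S A V n ω).1 with hq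
  set e : ℕ → EventType := fun n => eventType S A V n ω with he
  have hidle : ∀ n, q n = 0 → e n = EventType.arrival := fun n hn => if_pos (Or.inl hn)
  have hnext : ∀ n, q (n + 1) = nextLength (q n) (e n) := fun n => by
    simp only [hq, simState_succ, fst_step]
    rfl
  have hlim := hπ q e hidle hnext hsign
  have hbusy := hlim.const_sub 1
  set L₁ := Real.log (lam / (lam + nu)) with hL₁
  set L₂ := Real.log (nu / (lam + nu)) with hL₂
  constructor
  -- An idle server makes the arrival certain, with log-likelihood 0. When it is busy, the mean is
  -- minus the entropy of the mark and the rest is a multiple of `centredSign`.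
  · have hterm : ∀ n, Real.log ((eventLaw P S A V n ω).real {e n}) =
        (lam / (lam + nu) * L₁ + nu / (lam + nu) * L₂) * (1 - if q n = 0 then 1 else 0) +
          (L₁ - L₂) / 2 * centredSign ((lam - nu) / (lam + nu)) (q n) (e n) := fun n => by
      rw [hevent n]
      by_cases h : q n = 0
      · rw [h, centredSign_zero, hidle n h]
        have : (simState S A V n ω).1 = 0 := h
        rw [this]
        simp [markLaw, Measure.real]
      · rw [log_measureReal_markLaw_of_ne ha hb h, centredSign_of_ne h, if_neg h, ← hL₁, ← hL₂]
        field_simp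
        ring
    have hmain := ((hbusy.const_mul (lam / (lam + nu) * L₁ + nu / (lam + nu) * L₂)).add
      (hsign.const_mul ((L₁ - L₂) / 2))).neg
    have hval : -((lam / (lam + nu) * L₁ + nu / (lam + nu) * L₂) * (1 - π) + (L₁ - L₂) / 2 * 0) =
        -((1 - π) * (lam / (lam + nu) * L₁ + nu / (lam + nu) * L₂)) := by ring
    rw [hval] at hmain
    refine hmain.congr' ?_
    filter_upwards [eventually_gt_atTop 0] with N hN
    have hN' : (N : ℝ) ≠ 0 := by positivity
    have hsum : ∑ n ∈ Finset.range N, Real.log ((eventLaw P S A V n ω).real {e n}) =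
        (lam / (lam + nu) * L₁ + nu / (lam + nu) * L₂) * (N - idleCount q N) + (L₁ - L₂) / 2 *
          ∑ n ∈ Finset.range N, centredSign ((lam - nu) / (lam + nu)) (q n) (e n) := by
      simp_rw [hterm]
      rw [Finset.sum_add_distrib, ← Finset.mul_sum, ← Finset.mul_sum, Finset.sum_sub_distrib]
      simp [idleCount]
    have hdef : avgEventLoss P S A V N ω = -((1 / (N : ℝ)) *
        ∑ n ∈ Finset.range N, Real.log ((eventLaw P S A V n ω).real {e n})) := rfl
    rw [hdef, hsum]
    generalize (∑ n ∈ Finset.range N, centredSign ((lam - nu) / (lam + nu)) (q n) (e n)) = σ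
    generalize lam / (lam + nu) * L₁ + nu / (lam + nu) * L₂ = H
    field_simp
  -- The centred squared error plus the conditional variance: `1 / lam ^ 2` when idle, `1 / (lam +
  -- nu) ^ 2` when busy.
  · have hterm : ∀ n, (1 / exponentialRate (timeLaw P S A V n ω) - interTime S A V n ω) ^ 2 =
        ((1 / eventRate lam nu (q n) - interTime S A V n ω) ^ 2 -
          1 / eventRate lam nu (q n) ^ 2) +
        (1 / (lam + nu) ^ 2 + (1 / lam ^ 2 - 1 / (lam + nu) ^ 2) *
          if q n = 0 then 1 else 0) := fun n => by
      rw [htime n, exponentialRate_expMeasure (hr _)]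
      by_cases h : q n = 0
      · have h' : eventRate lam nu (q n) = lam := if_pos h
        simp only [if_pos h, h']
        have h'' : eventRate lam nu (simState S A V n ω).1 = lam := h'
        rw [h'']
        ring
      · have h' : eventRate lam nu (q n) = lam + nu := if_neg h
        simp only [if_neg h, h']
        have h'' : eventRate lam nu (simState S A V n ω).1 = lam + nu := h'
        rw [h'']
        ring
    have hmain := (hsq.add_const (1 / (lam + nu) ^ 2)).add
      (hlim.const_mul (1 / lam ^ 2 - 1 / (lam + nu) ^ 2))
    have hval : 0 + 1 / (lam + nu) ^ 2 + (1 / lam ^ 2 - 1 / (lam + nu) ^ 2) * π =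
        π / lam ^ 2 + (1 - π) / (lam + nu) ^ 2 := by ring
    rw [hval] at hmain
    refine hmain.congr' ?_
    filter_upwards [eventually_gt_atTop 0] with N hN
    have hN' : (N : ℝ) ≠ 0 := by positivity
    rw [avgTimeLoss]
    simp_rw [hterm]
    rw [Finset.sum_add_distrib, Finset.sum_add_distrib, ← Finset.mul_sum, ← idleCount,
      Finset.sum_const, Finset.card_range, nsmul_eq_mul]
    generalize (∑ n ∈ Finset.range N, ((1 / eventRate lam nu (q n) - interTime S A V n ω) ^ 2 -
      1 / eventRate lam nu (q n) ^ 2)) = σ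
    generalize 1 / lam ^ 2 - 1 / (lam + nu) ^ 2 = H
    field_simp
    ring

end

end MM1

end

/-! ### The two traffic regimes -/

theorem mainTheorem7 {Ω : Type*} [MeasurableSpace Ω] (P : Measure Ω) [IsProbabilityMeasure P]
    (lam nu : ℝ) (hlam : 0 < lam) (hnu : 0 < nu)
    (S : Ω → ℕ) (A V : ℕ → Ω → ℝ) (hQ : MM1.IsMM1Queue lam nu P S A V) :
    (∀ n : ℕ, ∀ᵐ ω ∂P, ∃ r : ℝ, 0 < r ∧ MM1.timeLaw P S A V n ω = expMeasure r) ∧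
    (lam / nu < 1 → ∀ᵐ ω ∂P,
      Tendsto (fun N : ℕ => MM1.avgEventLoss P S A V N ω) atTop
        (𝓝 (-(1 / 2) * (lam / nu * Real.log (lam / (lam + nu)) +
          Real.log (nu / (lam + nu))))) ∧
      Tendsto (fun N : ℕ => MM1.avgTimeLoss P S A V N ω) atTop
        (𝓝 (1 / (2 * lam ^ 2) * (nu / (lam + nu))))) ∧
    (1 ≤ lam / nu → ∀ᵐ ω ∂P,
      Tendsto (fun N : ℕ => MM1.avgEventLoss P S A V N ω) atTop
        (𝓝 (-(lam / (lam + nu)) * Real.log (lam / (lam + nu)) -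
          nu / (lam + nu) * Real.log (nu / (lam + nu)))) ∧
      Tendsto (fun N : ℕ => MM1.avgTimeLoss P S A V N ω) atTop
        (𝓝 (1 / (lam + nu) ^ 2))) := by
  have hl : Fact (0 < lam) := ⟨hlam⟩
  have hn : Fact (0 < nu) := ⟨hnu⟩
  refine ⟨fun n => ?_, fun hρ => ?_, fun hρ => ?_⟩
  · filter_upwards [hQ.timeLaw_ae_eq n] with ω hω
    exact ⟨_, (Fact.out : 0 < MM1.eventRate lam nu _), hω⟩
  · have hlt : lam < nu := (div_lt_one hnu).1 hρ
    have hc : (lam - nu) / (lam + nu) ≤ 0 :=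
      div_nonpos_of_nonpos_of_nonneg (by linarith) (by positivity)
    filter_upwards [hQ.ae_tendsto_losses fun q e hidle hnext =>
      MM1.tendsto_idleCount_div_of_drift_nonpos hidle hnext hc] with ω hω
    have h1 : 1 - (lam - nu) / (lam + nu) = 2 * nu / (lam + nu) := by
      field_simp
      ring
    -- Idle starts are counted per event: the fraction is `(1 - ρ) / 2`, with `ρ = lam / nu`.
    have hπ : -((lam - nu) / (lam + nu)) / (1 - (lam - nu) / (lam + nu)) =
        (nu - lam) / (2 * nu) := by
      rw [h1]
      field_simp
      ring
    rw [hπ] at hω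
    refine ⟨?_, ?_⟩
    · convert hω.1 using 2
      field_simp
      ring
    · convert hω.2 using 2
      field_simp
      ring
  · have hle : nu ≤ lam := (one_le_div hnu).1 hρ
    have hc : 0 ≤ (lam - nu) / (lam + nu) := div_nonneg (by linarith) (by positivity)
    filter_upwards [hQ.ae_tendsto_losses fun q e hidle hnext =>
      MM1.tendsto_idleCount_div_of_drift_nonneg hidle hnext hc] with ω hω
    refine ⟨?_, ?_⟩
    -- Here `π = 0`: asymptotically all events start with a busy server, including in the critical
    -- case `lam = nu`.
    · convert hω.1 using 2
      ring
    · convert hω.2 using 2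
      ring
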